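/- For $n\in\mathbb N$ write $[n]=\{1,\dots,n\}$ and let $\binom{[n]}{k}$ be the set of all $k$-element subsets of $[n]$. A family $\mathcal J$ of sets is \emph{$t$-intersecting} if $|A\cap B|\ge t$ for all $A,B\in\mathcal J$ (including $A=B$). A family $\mathcal J\subset\binom{[n]}{k}$ is a \emph{$j$-junta} if there are a set $J\subset[n]$ with $|J|=j$ and a family $\mathcal G$ of subsets of $J$ such that, for every $S\in\binom{[n]}{k}$, $S\in\mathcal J$ if and only if $S\cap J\in\mathcal G$. \textbf{Theorem.} For any real $\epsilon,\zeta>0$ and any integer $t\ge 1$ there exist $j=j(t,\zeta,\epsilon)\in\mathbb N$ and $n_1=n_1(t,\zeta,\epsilon)\in\mathbb N$ such that the following holds. Let $n\ge n_1$, let $k$ be an integer with $\zeta n\le k\le(\tfrac12-\zeta)n$, and let $\mathcal F\subset\binom{[n]}{k}$ be a family such that no two distinct sets in $\mathcal F$ have intersection of size exactly $t-1$. Then there exists a $t$-intersecting $j$-junta $\mathcal J\subset\binom{[n]}{k}$ such that $$|\mathcal F\setminus\mathcal J|<\epsilon\binom nk .$$ -/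

import Mathlib

/-- A family of sets is `t`-intersecting if `|A ∩ B| ≥ t` for all members `A`, `B`
(the case `A = B` included). -/
def IsTIntersecting {n : ℕ} (t : ℕ) (𝒜 : Finset (Finset (Fin n))) : Prop :=
  ∀ A ∈ 𝒜, ∀ B ∈ 𝒜, t ≤ (A ∩ B).card

/-- `𝒥` is a family of `k`-element subsets of an `n`-element ground set which is a `J`-junta:
for some family `𝒢` of subsets of `J`, a `k`-set `S` belongs to `𝒥` iff `S ∩ J ∈ 𝒢`. -/
def IsJuntaOn {n : ℕ} (k : ℕ) (J : Finset (Fin n)) (𝒥 : Finset (Finset (Fin n))) : Prop :=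
  𝒥 ⊆ Finset.powersetCard k Finset.univ ∧
    ∃ 𝒢 : Finset (Finset (Fin n)), 𝒢 ⊆ J.powerset ∧
      ∀ S ∈ Finset.powersetCard k (Finset.univ : Finset (Fin n)), S ∈ 𝒥 ↔ S ∩ J ∈ 𝒢

/-- `𝒥` is a `j`-junta of `k`-sets: a `J`-junta for some set `J` with exactly `j` elements. -/
def IsJunta {n : ℕ} (k j : ℕ) (𝒥 : Finset (Finset (Fin n))) : Prop :=
  ∃ J : Finset (Fin n), J.card = j ∧ IsJuntaOn k J 𝒥

/-! The junta consists of the `k`-sets whose trace on a bounded set `J` is robust: the slice of `ℱ`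
there is dense, and stays dense after fixing boundedly many further coordinates. A density-increment
argument with a bounded potential (`exists_robust_slices`) finds a `J` for which few members of `ℱ`
lie outside robust slices.

Suppose two robust traces meet in fewer than `t` points. Adjoin to both a set `S` outside `J` that
brings the common part to exactly `t - 1`. By `exists_half_lt_upIndicator` the up-closures of the
two refined slices each have measure above 1/2 in the uniform cube, so some `y` lies in one while
`yᶜ` lies in the other (`exists_compl_of_half_lt`). The members of `ℱ` below `y` and `yᶜ` are
disjoint off `J ∪ S`, hence meet in exactly `t - 1` points, which is forbidden.

The measure bound is a sharp-threshold argument, and it is where `k/n` must stay below 1/2. Density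
of a slice gives a lower bound for the measure of its up-closure at biases in `[1/2 - ζ/2, 1/2]`
(`half_mul_le_biasedAvg`). By Russo's formula the total influence is bounded at some such bias, so
few coordinates are influential. The Falik–Samorodnitsky inequality (`biasedAvg_sq_sub_le`) makes
the variance over the others small, while robustness keeps the average over them bounded below
whatever the influential ones are. So the measure is near 1 (`exists_half_lt_biasedAvg`). -/

section BiasedCube

/-! ### Averaging operators on the biased cube. -/

variable {α : Type*} [DecidableEq α]

theorem insert_erase_eq_insert (x : Finset α) (i : α) : insert i (x.erase i) = insert i x := by
  ext a; simp only [Finset.mem_insert, Finset.mem_erase]; tauto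

/-- Average over the `i`-th coordinate, which is present with probability `q`. -/
def coordAvg (q : ℝ) (i : α) (f : Finset α → ℝ) (x : Finset α) : ℝ :=
  q * f (insert i x) + (1 - q) * f (x.erase i)

/-- Average of `f` over the coordinates in `V`, each present independently with
probability `q`; the coordinates outside `V` are those of `x`. -/
def biasedAvg (q : ℝ) (V : Finset α) (f : Finset α → ℝ) (x : Finset α) : ℝ :=
  ∑ y ∈ V.powerset, q ^ y.card * (1 - q) ^ (V.card - y.card) * f (y ∪ (x \ V))

theorem biasedAvg_empty (q : ℝ) (f : Finset α → ℝ) : biasedAvg q ∅ f = f := by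
  ext x; simp [biasedAvg]

/-- Product structure of the measure: averages over several coordinates are iterated one-coordinate
averages, which is what drives the inductions on `V`. -/
theorem biasedAvg_insert (q : ℝ) {i : α} {V : Finset α} (hi : i ∉ V) (f : Finset α → ℝ) :
    biasedAvg q (insert i V) f = coordAvg q i (biasedAvg q V f) := by
  ext x
  unfold coordAvg biasedAvg
  rw [Finset.sum_powerset_insert hi, Finset.mul_sum, Finset.mul_sum, add_comm]
  congr 1
  · refine Finset.sum_congr rfl fun y hy => ?_
    have hy' : i ∉ y := fun h => hi (Finset.mem_powerset.1 hy h)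
    have hs : insert i y ∪ (x \ insert i V) = y ∪ (insert i x \ V) := by
      ext a; simp only [Finset.mem_union, Finset.mem_insert, Finset.mem_sdiff]
      by_cases h : a = i
      · subst h; simp [hi]
      · simp [h]
    rw [hs, Finset.card_insert_of_notMem hi, Finset.card_insert_of_notMem hy',
      Nat.add_sub_add_right]
    ring
  · refine Finset.sum_congr rfl fun y hy => ?_
    have hy' := Finset.card_le_card (Finset.mem_powerset.1 hy)
    have hs : y ∪ (x \ insert i V) = y ∪ (x.erase i \ V) := by
      ext a; simp only [Finset.mem_union, Finset.mem_insert, Finset.mem_sdiff, Finset.mem_erase]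
      tauto
    rw [hs, Finset.card_insert_of_notMem hi, Nat.succ_sub hy', pow_succ]
    ring

theorem coordAvg_comm (q : ℝ) (i j : α) (f : Finset α → ℝ) :
    coordAvg q i (coordAvg q j f) = coordAvg q j (coordAvg q i f) := by
  by_cases h : i = j
  · rw [h]
  · ext x
    simp only [coordAvg, Finset.insert_comm i j, Finset.erase_right_comm (a := i) (b := j),
      Finset.erase_insert_of_ne h, Finset.erase_insert_of_ne (Ne.symm h)]
    ring

theorem coordAvg_idem (q : ℝ) (i : α) (f : Finset α → ℝ) :
    coordAvg q i (coordAvg q i f) = coordAvg q i f := by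
  ext x
  simp only [coordAvg, Finset.insert_idem, Finset.erase_idem, insert_erase_eq_insert,
    Finset.erase_insert_eq_erase]
  ring

theorem biasedAvg_coordAvg (q : ℝ) (i : α) (V : Finset α) (f : Finset α → ℝ) :
    biasedAvg q V (coordAvg q i f) = coordAvg q i (biasedAvg q V f) := by
  induction V using Finset.induction_on with
  | empty => simp only [biasedAvg_empty]
  | insert j V hj ih => rw [biasedAvg_insert q hj, biasedAvg_insert q hj, ih, coordAvg_comm]

theorem biasedAvg_coordAvg_of_mem (q : ℝ) {i : α} {V : Finset α} (hi : i ∈ V)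
    (f : Finset α → ℝ) : biasedAvg q V (coordAvg q i f) = biasedAvg q V f := by
  rw [← Finset.insert_erase hi, biasedAvg_insert q (Finset.notMem_erase i V),
    biasedAvg_coordAvg, coordAvg_idem, biasedAvg_insert q (Finset.notMem_erase i V)]

theorem biasedAvg_sub (q : ℝ) (V : Finset α) (f g : Finset α → ℝ) :
    biasedAvg q V (fun x => f x - g x) = fun x => biasedAvg q V f x - biasedAvg q V g x := by
  ext x; simp only [biasedAvg, mul_sub, Finset.sum_sub_distrib]

theorem biasedAvg_const_mul (q c : ℝ) (V : Finset α) (f : Finset α → ℝ) :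
    biasedAvg q V (fun x => c * f x) = fun x => c * biasedAvg q V f x := by
  ext x; simp only [biasedAvg, Finset.mul_sum]
  exact Finset.sum_congr rfl fun y _ => by ring

theorem biasedAvg_const (q c : ℝ) (V : Finset α) :
    biasedAvg q V (fun _ => c) = fun _ => c := by
  induction V using Finset.induction_on with
  | empty => simp only [biasedAvg_empty]
  | insert j V hj ih => rw [biasedAvg_insert q hj, ih]; ext x; simp only [coordAvg]; ring

theorem biasedAvg_mono {q : ℝ} (h0 : 0 ≤ q) (h1 : q ≤ 1) (V : Finset α) {f g : Finset α → ℝ}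
    (h : ∀ x, f x ≤ g x) (x : Finset α) : biasedAvg q V f x ≤ biasedAvg q V g x := by
  have := sub_nonneg.2 h1
  exact Finset.sum_le_sum fun y _ => mul_le_mul_of_nonneg_left (h _) (by positivity)

theorem biasedAvg_nonneg {q : ℝ} (h0 : 0 ≤ q) (h1 : q ≤ 1) (V : Finset α) {f : Finset α → ℝ}
    (h : ∀ x, 0 ≤ f x) (x : Finset α) : 0 ≤ biasedAvg q V f x := by
  simpa only [biasedAvg_const] using biasedAvg_mono h0 h1 V (f := fun _ => 0) h x

theorem abs_biasedAvg_le {q : ℝ} (h0 : 0 ≤ q) (h1 : q ≤ 1) (V : Finset α) (f : Finset α → ℝ)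
    (x : Finset α) : |biasedAvg q V f x| ≤ biasedAvg q V (fun y => |f y|) x := by
  have := sub_nonneg.2 h1
  refine (Finset.abs_sum_le_sum_abs _ _).trans (Finset.sum_le_sum fun y _ => ?_)
  rw [abs_mul, abs_of_nonneg (a := _ * _) (by positivity)]

/-- Cauchy–Schwarz. -/
theorem biasedAvg_mul_le {q : ℝ} (h0 : 0 ≤ q) (h1 : q ≤ 1) (V : Finset α)
    (f g : Finset α → ℝ) (x x' : Finset α) :
    ∑ y ∈ V.powerset, q ^ y.card * (1 - q) ^ (V.card - y.card) *
        (f (y ∪ (x \ V)) * g (y ∪ (x' \ V))) ≤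
      √(biasedAvg q V (fun y => f y ^ 2) x) * √(biasedAvg q V (fun y => g y ^ 2) x') := by
  have := sub_nonneg.2 h1
  have key := Real.sum_mul_le_sqrt_mul_sqrt V.powerset
    (fun y => √(q ^ y.card * (1 - q) ^ (V.card - y.card)) * f (y ∪ (x \ V)))
    (fun y => √(q ^ y.card * (1 - q) ^ (V.card - y.card)) * g (y ∪ (x' \ V)))
  have hw : ∀ y : Finset α, 0 ≤ q ^ y.card * (1 - q) ^ (V.card - y.card) := fun y => by positivity
  have e : ∀ y : Finset α, ∀ a b : ℝ,
      √(q ^ y.card * (1 - q) ^ (V.card - y.card)) * a *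
        (√(q ^ y.card * (1 - q) ^ (V.card - y.card)) * b) =
      q ^ y.card * (1 - q) ^ (V.card - y.card) * (a * b) := fun y a b => by
    rw [mul_mul_mul_comm, Real.mul_self_sqrt (hw y)]
  have e' : ∀ y : Finset α, ∀ a : ℝ,
      (√(q ^ y.card * (1 - q) ^ (V.card - y.card)) * a) ^ 2 =
      q ^ y.card * (1 - q) ^ (V.card - y.card) * a ^ 2 := fun y a => by
    rw [mul_pow, Real.sq_sqrt (hw y)]
  simpa only [e, e', biasedAvg] using key

/-! ### Deviations and the logarithmic Sobolev inequality. -/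

/-- The deviation of `f` from its average over the `i`-th coordinate. -/
def coordDev (q : ℝ) (i : α) (f : Finset α → ℝ) (x : Finset α) : ℝ := f x - coordAvg q i f x

theorem biasedAvg_coordDev (q : ℝ) (i : α) (V : Finset α) (f : Finset α → ℝ) :
    biasedAvg q V (coordDev q i f) = coordDev q i (biasedAvg q V f) := by
  unfold coordDev
  rw [biasedAvg_sub, biasedAvg_coordAvg]

theorem coordAvg_coordDev_sq (q : ℝ) (i : α) (f : Finset α → ℝ) (x : Finset α) :
    coordAvg q i (fun y => coordDev q i f y ^ 2) x =
      q * (1 - q) * (f (insert i x) - f (x.erase i)) ^ 2 := by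
  simp only [coordDev, coordAvg, Finset.insert_idem, Finset.erase_idem,
    insert_erase_eq_insert, Finset.erase_insert_eq_erase]
  ring

theorem coordAvg_coordDev_sq' (q : ℝ) (i : α) (f : Finset α → ℝ) (x : Finset α) :
    coordAvg q i (fun y => coordDev q i f y ^ 2) x =
      coordAvg q i (fun y => f y ^ 2 - coordAvg q i f y ^ 2) x := by
  simp only [coordDev, coordAvg, Finset.insert_idem, Finset.erase_idem,
    insert_erase_eq_insert, Finset.erase_insert_eq_erase]
  ring

/-- Pythagoras: `coordAvg` is an orthogonal projection for the biased inner product. -/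
theorem biasedAvg_coordDev_sq (q : ℝ) {i : α} {V : Finset α} (hi : i ∈ V) (f : Finset α → ℝ)
    (x : Finset α) : biasedAvg q V (fun y => coordDev q i f y ^ 2) x =
      biasedAvg q V (fun y => f y ^ 2) x - biasedAvg q V (fun y => coordAvg q i f y ^ 2) x := by
  rw [← biasedAvg_coordAvg_of_mem q hi, funext (coordAvg_coordDev_sq' q i f),
    biasedAvg_coordAvg_of_mem q hi, biasedAvg_sub]

/-- The two-point logarithmic Sobolev inequality. -/
theorem entropy_two_point_le {q a b : ℝ} (h0 : 1 / 4 ≤ q) (h1 : q ≤ 3 / 4) (ha : 0 ≤ a)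
    (hb : 0 ≤ b) :
    q * (a * Real.log a) + (1 - q) * (b * Real.log b) -
        (q * a + (1 - q) * b) * Real.log (q * a + (1 - q) * b) ≤
      8 * (q * (1 - q) * (√a - √b) ^ 2) := by
  set m := q * a + (1 - q) * b with hm
  have hm0 : 1 / 4 * (a + b) ≤ m := by rw [hm]; nlinarith
  rcases (add_nonneg ha hb).eq_or_lt with h | h
  · have ha' : a = 0 := by linarith
    have hb' : b = 0 := by linarith
    simp [hm, ha', hb']
  have hmp : 0 < m := by linarith
  -- The bound `log u ≤ u - 1` at `u = c / m` dominates the entropy by the variance divided by `m`.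
  have key : ∀ c : ℝ, 0 ≤ c → c * Real.log c ≤ c * Real.log m + (c ^ 2 / m - c) := by
    intro c hc
    rcases hc.eq_or_lt with rfl | hc
    · simp
    have := Real.log_le_sub_one_of_pos (div_pos hc hmp)
    rw [Real.log_div hc.ne' hmp.ne'] at this
    have := mul_le_mul_of_nonneg_left this hc.le
    have e : c * (c / m - 1) = c ^ 2 / m - c := by ring
    linarith
  have k1 := mul_le_mul_of_nonneg_left (key a ha) (by linarith : 0 ≤ q)
  have k2 := mul_le_mul_of_nonneg_left (key b hb) (by linarith : 0 ≤ 1 - q)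
  have e : q * (a * Real.log m + (a ^ 2 / m - a)) + (1 - q) * (b * Real.log m + (b ^ 2 / m - b))
      - m * Real.log m = q * (1 - q) * (a - b) ^ 2 / m := by
    field_simp
    rw [hm]; ring
  have h3 : q * (1 - q) * (a - b) ^ 2 / m ≤ 8 * (q * (1 - q) * (√a - √b) ^ 2) := by
    rw [div_le_iff₀ hmp]
    have hab : (a - b) ^ 2 = (√a - √b) ^ 2 * (√a + √b) ^ 2 := by
      rw [← mul_pow, ← Real.sq_sqrt ha, ← Real.sq_sqrt hb]
      simp only [Real.sqrt_sq (Real.sqrt_nonneg _)]; ring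
    -- Here `(√a + √b)² ≤ 2(a + b)`, and `a + b ≤ 4m` because both weights are at least 1/4; hence
    -- the constant 8.
    have h4 : (√a + √b) ^ 2 ≤ 8 * m := by
      have := sq_nonneg (√a - √b)
      nlinarith [Real.sq_sqrt ha, Real.sq_sqrt hb]
    have h5 : 0 ≤ q * (1 - q) * (√a - √b) ^ 2 := by
      have : 0 ≤ 1 - q := by linarith
      have : 0 ≤ q := by linarith
      positivity
    rw [hab]
    nlinarith [mul_le_mul_of_nonneg_left h4 h5]
  linarith

/-- The logarithmic Sobolev inequality for the biased cube. -/
theorem biasedAvg_entropy_le {q : ℝ} (h0 : 1 / 4 ≤ q) (h1 : q ≤ 3 / 4) (V : Finset α)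
    (g : Finset α → ℝ) (x : Finset α) :
    biasedAvg q V (fun y => g y ^ 2 * Real.log (g y ^ 2)) x -
        biasedAvg q V (fun y => g y ^ 2) x * Real.log (biasedAvg q V (fun y => g y ^ 2) x) ≤
      8 * ∑ j ∈ V, biasedAvg q V (fun y => coordDev q j g y ^ 2) x := by
  have hq0 : 0 ≤ q := by linarith
  have hq1 : q ≤ 1 := by linarith
  have hq1' : 0 ≤ 1 - q := by linarith
  induction V using Finset.induction_on generalizing x with
  | empty => simp [biasedAvg_empty]
  | insert i V hi ih =>
    rw [Finset.sum_insert hi]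
    -- Reverse triangle inequality: the L² norms of `g` on the two fibres differ by at most the L²
    -- norm of the difference. This charges the entropy between fibres to coordinate `i`.
    have hlast : q * (1 - q) * (√(biasedAvg q V (fun y => g y ^ 2) (insert i x)) -
        √(biasedAvg q V (fun y => g y ^ 2) (x.erase i))) ^ 2 ≤
        biasedAvg q (insert i V) (fun y => coordDev q i g y ^ 2) x := by
      rw [← biasedAvg_coordAvg_of_mem q (Finset.mem_insert_self i V),
        funext (coordAvg_coordDev_sq q i g), biasedAvg_const_mul, biasedAvg_insert q hi]
      refine mul_le_mul_of_nonneg_left ?_ (by positivity)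
      have A1 := biasedAvg_nonneg hq0 hq1 V (f := fun y => g y ^ 2) (fun _ => sq_nonneg _)
      have cs := biasedAvg_mul_le hq0 hq1 V g g (insert i x) (x.erase i)
      have e : coordAvg q i (biasedAvg q V fun y => (g (insert i y) - g (y.erase i)) ^ 2) x =
          biasedAvg q V (fun y => g y ^ 2) (insert i x) +
          biasedAvg q V (fun y => g y ^ 2) (x.erase i) -
          2 * ∑ y ∈ V.powerset, q ^ y.card * (1 - q) ^ (V.card - y.card) *
            (g (y ∪ (insert i x \ V)) * g (y ∪ (x.erase i \ V))) := by
        have e1 : ∀ z : Finset α, insert i (z.erase i) = insert i z ∧ (insert i z).erase i = z.erase i :=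
          fun z => ⟨insert_erase_eq_insert z i, Finset.erase_insert_eq_erase z i⟩
        have e2 : ∀ y ∈ V.powerset, ∀ z, insert i (y ∪ (z \ V)) = y ∪ (insert i z \ V) := by
          intro y _ z
          ext a; simp only [Finset.mem_union, Finset.mem_insert, Finset.mem_sdiff]
          by_cases h : a = i
          · subst h; simp [hi]
          · simp [h]
        have e3 : ∀ y ∈ V.powerset, ∀ z, (y ∪ (z \ V)).erase i = y ∪ (z.erase i \ V) := by
          intro y hy z
          have : i ∉ y := fun h => hi (Finset.mem_powerset.1 hy h)
          ext a; simp only [Finset.mem_union, Finset.mem_erase, Finset.mem_sdiff]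
          by_cases h : a = i
          · subst h; simp [this]
          · simp [h]
        have e4 : ∀ z, biasedAvg q V (fun y => (g (insert i y) - g (y.erase i)) ^ 2) z =
            biasedAvg q V (fun y => g y ^ 2) (insert i z) +
            biasedAvg q V (fun y => g y ^ 2) (z.erase i) -
            2 * ∑ y ∈ V.powerset, q ^ y.card * (1 - q) ^ (V.card - y.card) *
              (g (y ∪ (insert i z \ V)) * g (y ∪ (z.erase i \ V))) := by
          intro z
          simp only [biasedAvg, Finset.mul_sum, ← Finset.sum_add_distrib, ← Finset.sum_sub_distrib]
          refine Finset.sum_congr rfl fun y hy => ?_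
          rw [e2 y hy, e3 y hy]; ring
        unfold coordAvg
        rw [e4, e4]
        simp only [e1, Finset.insert_idem, Finset.erase_idem]
        ring
      rw [e]
      nlinarith [Real.sq_sqrt (A1 (insert i x)), Real.sq_sqrt (A1 (x.erase i))]
    have A1 := biasedAvg_nonneg hq0 hq1 V (f := fun y => g y ^ 2) (fun _ => sq_nonneg _)
    have t := entropy_two_point_le h0 h1 (A1 (insert i x)) (A1 (x.erase i))
    have i1 := mul_le_mul_of_nonneg_left (ih (insert i x)) hq0
    have i2 := mul_le_mul_of_nonneg_left (ih (x.erase i)) hq1'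
    have e : ∑ j ∈ V, biasedAvg q (insert i V) (fun y => coordDev q j g y ^ 2) x =
        q * ∑ j ∈ V, biasedAvg q V (fun y => coordDev q j g y ^ 2) (insert i x) +
        (1 - q) * ∑ j ∈ V, biasedAvg q V (fun y => coordDev q j g y ^ 2) (x.erase i) := by
      simp only [biasedAvg_insert q hi, coordAvg, Finset.sum_add_distrib, Finset.mul_sum]
    rw [e]
    simp only [biasedAvg_insert q hi] at hlast ⊢
    simp only [coordAvg] at hlast ⊢
    linarith

/-! ### Russo's formula and monotonicity. -/

/-- The discrete derivative in the `i`-th coordinate. -/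
def coordDiff (i : α) (f : Finset α → ℝ) (x : Finset α) : ℝ := f (insert i x) - f (x.erase i)

theorem coordAvg_coordDiff (q : ℝ) (i : α) (f : Finset α → ℝ) :
    coordAvg q i (coordDiff i f) = coordDiff i f := by
  ext x
  simp only [coordAvg, coordDiff, Finset.insert_idem, Finset.erase_idem,
    insert_erase_eq_insert, Finset.erase_insert_eq_erase]
  ring

theorem biasedAvg_coordDiff (q : ℝ) {i : α} {V : Finset α} (hi : i ∉ V) (f : Finset α → ℝ)
    (x : Finset α) : biasedAvg q V (coordDiff i f) x =
      biasedAvg q V f (insert i x) - biasedAvg q V f (x.erase i) := by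
  simp only [biasedAvg, ← Finset.sum_sub_distrib]
  refine Finset.sum_congr rfl fun y hy => ?_
  have hy' : i ∉ y := fun h => hi (Finset.mem_powerset.1 hy h)
  have e2 : insert i (y ∪ (x \ V)) = y ∪ (insert i x \ V) := by
    ext a; simp only [Finset.mem_union, Finset.mem_insert, Finset.mem_sdiff]
    by_cases h : a = i
    · subst h; simp [hi]
    · simp [h]
  have e3 : (y ∪ (x \ V)).erase i = y ∪ (x.erase i \ V) := by
    ext a; simp only [Finset.mem_union, Finset.mem_erase, Finset.mem_sdiff]
    by_cases h : a = i
    · subst h; simp [hy']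
    · simp [h]
  rw [coordDiff, e2, e3]; ring

theorem coordDev_comm (q : ℝ) (i j : α) (f : Finset α → ℝ) :
    coordDev q i (coordDev q j f) = coordDev q j (coordDev q i f) := by
  ext x
  have := congrFun (coordAvg_comm q i j f) x
  simp only [coordDev, coordAvg] at this ⊢
  linarith

/-- Russo's formula. -/
theorem hasDerivAt_biasedAvg (q : ℝ) (V : Finset α) (f : Finset α → ℝ) (x : Finset α) :
    HasDerivAt (fun p => biasedAvg p V f x) (∑ j ∈ V, biasedAvg q V (coordDiff j f) x) q := by
  induction V using Finset.induction_on generalizing x with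
  | empty => simpa [biasedAvg_empty] using hasDerivAt_const q (f x)
  | insert i V hi ih =>
    have h1 := ((hasDerivAt_id q).mul (ih (insert i x))).add
      (((hasDerivAt_id q).const_sub 1).mul (ih (x.erase i)))
    rw [Finset.sum_insert hi, ← biasedAvg_coordAvg_of_mem q (Finset.mem_insert_self i V)]
    simp only [biasedAvg_insert _ hi]
    refine h1.congr_deriv ?_
    rw [coordAvg_coordDiff, ← biasedAvg_insert q hi,
      ← biasedAvg_coordAvg_of_mem q (Finset.mem_insert_self i V), biasedAvg_insert q hi,
      ← biasedAvg_coordAvg, coordAvg_coordDiff, coordAvg_coordDiff, biasedAvg_coordDiff q hi]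
    simp only [coordAvg, Finset.sum_add_distrib, Finset.mul_sum, id]
    ring

/-- At `∅` the coordinates that are not averaged are absent, the least favourable setting for a
monotone function. -/
theorem biasedAvg_le_of_subset {q : ℝ} (h0 : 0 ≤ q) (h1 : q ≤ 1) {W V : Finset α}
    (hWV : W ⊆ V) {f : Finset α → ℝ} (hf : Monotone f) :
    biasedAvg q W f ∅ ≤ biasedAvg q V f ∅ := by
  have key : ∀ D : Finset α, biasedAvg q W f ∅ ≤ biasedAvg q (D ∪ W) f ∅ := by
    intro D
    induction D using Finset.induction_on with
    | empty => simp
    | insert i D hi ih =>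
      rw [Finset.insert_union]
      by_cases hiW : i ∈ D ∪ W
      · rwa [Finset.insert_eq_of_mem hiW]
      · refine ih.trans ?_
        rw [biasedAvg_insert q hiW, coordAvg, Finset.erase_empty]
        have : biasedAvg q (D ∪ W) f ∅ ≤ biasedAvg q (D ∪ W) f (insert i ∅) := by
          have := sub_nonneg.2 h1
          refine Finset.sum_le_sum fun y _ => mul_le_mul_of_nonneg_left (hf ?_) (by positivity)
          exact Finset.union_subset_union_right
            (Finset.sdiff_subset_sdiff (Finset.empty_subset _) le_rfl)
        nlinarith
  simpa [Finset.sdiff_union_of_subset hWV] using key (V \ W)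

/-! ### Influences and variance. -/

/-- A linearised lower bound for the entropy term, from `log u ≤ u - 1` at `u = 1 / (a|g|)`; the
parameter `a` is free for later optimisation. -/
theorem two_mul_sub_le_biasedAvg_sq_log {q : ℝ} (h0 : 0 ≤ q) (h1 : q ≤ 1) (V : Finset α)
    (g : Finset α → ℝ) (x : Finset α) {a : ℝ} (ha : 0 < a) :
    2 * (1 - Real.log a) * biasedAvg q V (fun y => g y ^ 2) x -
        2 / a * biasedAvg q V (fun y => |g y|) x ≤
      biasedAvg q V (fun y => g y ^ 2 * Real.log (g y ^ 2)) x := by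
  have key : ∀ y, 2 * (1 - Real.log a) * g y ^ 2 - 2 / a * |g y| ≤
      g y ^ 2 * Real.log (g y ^ 2) := by
    intro y
    rw [← sq_abs (g y)]
    rcases (abs_nonneg (g y)).eq_or_lt with h | h
    · simp [← h]
    · have h2 := Real.log_le_sub_one_of_pos (show 0 < 1 / (a * |g y|) by positivity)
      rw [Real.log_div one_ne_zero (by positivity), Real.log_one,
        Real.log_mul ha.ne' h.ne'] at h2
      have h3 := mul_le_mul_of_nonneg_left h2 (sq_nonneg |g y|)
      have e : |g y| ^ 2 * (1 / (a * |g y|) - 1) = 1 / a * |g y| - |g y| ^ 2 := by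
        field_simp
      have e' : (2 : ℝ) / a = 2 * (1 / a) := by ring
      rw [Real.log_pow, e']
      push_cast
      linarith
  have := biasedAvg_mono h0 h1 V key x
  rwa [biasedAvg_sub, biasedAvg_const_mul, biasedAvg_const_mul] at this

/-- A function with small `L¹` norm has either a small `L²` norm or a large entropy. -/
theorem mul_biasedAvg_sq_le {q : ℝ} (h0 : 0 ≤ q) (h1 : q ≤ 1) (V : Finset α)
    (g : Finset α → ℝ) (x : Finset α) {I δ L : ℝ} (hδ : 0 < δ) (hL : 0 < L)
    (hI : 0 ≤ I) (hg : biasedAvg q V (fun y => |g y|) x ≤ I) (hIδ : I ≤ δ * Real.exp (-L))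
    {S : ℝ} (hS : 0 ≤ S)
    (hent : biasedAvg q V (fun y => g y ^ 2 * Real.log (g y ^ 2)) x -
      biasedAvg q V (fun y => g y ^ 2) x * Real.log (biasedAvg q V (fun y => g y ^ 2) x) ≤ S) :
    L * biasedAvg q V (fun y => g y ^ 2) x ≤ L * δ * I + S := by
  set m := biasedAvg q V (fun y => g y ^ 2) x with hm
  by_cases hc : m ≤ δ * I
  · nlinarith
  push Not at hc
  have hm0 : 0 < m := lt_of_le_of_lt (by positivity) hc
  have hI2 : I ^ 2 ≤ Real.exp (-L) * m := by
    have h2 : I * (δ * I) ≤ δ * Real.exp (-L) * m := mul_le_mul hIδ hc.le (by positivity)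
      (by positivity)
    refine le_of_mul_le_mul_left ?_ hδ
    linarith
  -- With this `a` the L¹ term costs at most `2m`, cancelling the `2m` gained, and `-2m log a`
  -- supplies `L m + m log m`.
  set a := Real.exp (-L / 2) / √m with haa
  have hsm : 0 < √m := Real.sqrt_pos.2 hm0
  have ha : 0 < a := by positivity
  have h2 := two_mul_sub_le_biasedAvg_sq_log h0 h1 V g x ha
  have hla : Real.log a = -L / 2 - Real.log m / 2 := by
    rw [haa, Real.log_div (Real.exp_pos _).ne' hsm.ne', Real.log_exp, Real.log_sqrt hm0.le]
  have hIa : I ≤ m * a := by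
    have e : m * a = Real.exp (-L / 2) * √m := by
      rw [haa]; field_simp; rw [Real.sq_sqrt hm0.le]
    rw [e]
    refine abs_le_of_sq_le_sq' ?_ (by positivity) |>.2
    rw [mul_pow, Real.sq_sqrt hm0.le, ← Real.exp_nat_mul]
    have e2 : ((2 : ℕ) : ℝ) * (-L / 2) = -L := by push_cast; ring
    rwa [e2]
  have h3 : 2 / a * biasedAvg q V (fun y => |g y|) x ≤ 2 * m := by
    rw [div_mul_eq_mul_div, div_le_iff₀ ha]; linarith
  rw [hla, ← hm] at h2
  have : 0 ≤ L * δ * I := by positivity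
  nlinarith

variable [Fintype α]

theorem biasedAvg_univ_biasedAvg (q : ℝ) (V : Finset α) (f : Finset α → ℝ) :
    biasedAvg q Finset.univ (biasedAvg q V f) = biasedAvg q Finset.univ f := by
  induction V using Finset.induction_on with
  | empty => rw [biasedAvg_empty]
  | insert i V hi ih =>
    rw [biasedAvg_insert q hi, biasedAvg_coordAvg_of_mem q (Finset.mem_univ i), ih]

/-- The Falik–Samorodnitsky inequality: if all the influences from `V` are small, then the variance
of `f` on `V` is controlled by the energy of `f`. -/
theorem biasedAvg_sq_sub_le {q : ℝ} (h0 : 1 / 4 ≤ q) (h1 : q ≤ 3 / 4) (f : Finset α → ℝ)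
    {δ L : ℝ} (hδ : 0 < δ) (hL : 0 < L) (I : α → ℝ)
    (hI : ∀ i, biasedAvg q Finset.univ (fun y => |coordDev q i f y|) ∅ ≤ I i) (V : Finset α)
    (hV : ∀ i ∈ V, I i ≤ δ * Real.exp (-L)) :
    L * (biasedAvg q Finset.univ (fun y => f y ^ 2) ∅ -
        biasedAvg q Finset.univ (fun y => biasedAvg q V f y ^ 2) ∅) ≤
      L * δ * ∑ i ∈ V, I i + 8 * ∑ j, (biasedAvg q Finset.univ (fun y => coordDev q j f y ^ 2) ∅ -
        biasedAvg q Finset.univ (fun y => biasedAvg q V (coordDev q j f) y ^ 2) ∅) := by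
  have hq0 : 0 ≤ q := by linarith
  have hq1 : q ≤ 1 := by linarith
  induction V using Finset.induction_on with
  | empty => simp [biasedAvg_empty]
  | insert i V hi ih =>
    have ih := ih fun j hj => hV j (Finset.mem_insert_of_mem hj)
    have hstep : ∀ g : Finset α → ℝ,
        biasedAvg q Finset.univ (fun y => biasedAvg q V g y ^ 2) ∅ -
          biasedAvg q Finset.univ (fun y => biasedAvg q (insert i V) g y ^ 2) ∅ =
        biasedAvg q Finset.univ (fun y => coordDev q i (biasedAvg q V g) y ^ 2) ∅ := by
      intro g
      rw [biasedAvg_coordDev_sq q (Finset.mem_univ i), biasedAvg_insert q hi]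
    -- The martingale difference when coordinate `i` is averaged out after `V`. Averaging contracts
    -- L¹, so its L¹ norm is still at most `I i`.
    set g := coordDev q i (biasedAvg q V f) with hg
    have hl1 : biasedAvg q Finset.univ (fun y => |g y|) ∅ ≤ I i := by
      refine le_trans ?_ (hI i)
      rw [hg, ← biasedAvg_coordDev, ← biasedAvg_univ_biasedAvg q V (fun y => |coordDev q i f y|)]
      exact biasedAvg_mono hq0 hq1 _ (fun y => abs_biasedAvg_le hq0 hq1 V _ y) _
    have hI0 : 0 ≤ I i := le_trans (biasedAvg_nonneg hq0 hq1 _ (fun _ => abs_nonneg _) _) hl1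
    have hS : 0 ≤ 8 * ∑ j, biasedAvg q Finset.univ (fun y => coordDev q j g y ^ 2) ∅ :=
      mul_nonneg (by norm_num) (Finset.sum_nonneg fun j _ =>
        biasedAvg_nonneg hq0 hq1 _ (fun _ => sq_nonneg _) _)
    have h2 := mul_biasedAvg_sq_le hq0 hq1 Finset.univ g ∅ hδ hL hI0 hl1
      (hV i (Finset.mem_insert_self i V)) hS (biasedAvg_entropy_le h0 h1 Finset.univ g ∅)
    -- Deviations commute with averages, so the energies of the martingale differences telescope.
    have h3 : ∀ j, biasedAvg q Finset.univ (fun y => coordDev q j g y ^ 2) ∅ =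
        biasedAvg q Finset.univ (fun y => biasedAvg q V (coordDev q j f) y ^ 2) ∅ -
        biasedAvg q Finset.univ (fun y => biasedAvg q (insert i V) (coordDev q j f) y ^ 2) ∅ := by
      intro j
      rw [hstep, hg]
      rw [biasedAvg_coordDev, coordDev_comm]
    rw [← hstep] at h2
    simp only [h3, Finset.sum_sub_distrib] at h2 ih ⊢
    rw [Finset.sum_insert hi]
    linarith

end BiasedCube

/-! ### The sharp-threshold statement. -/

section BiasedCube

variable {α : Type*} [DecidableEq α]

theorem abs_coordDev_le {q : ℝ} (h0 : 0 ≤ q) (h1 : q ≤ 1) (i : α) {f : Finset α → ℝ}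
    (hf : Monotone f) (x : Finset α) : |coordDev q i f x| ≤ coordDiff i f x := by
  have a1 := hf (Finset.erase_subset i x)
  have a2 := hf (Finset.subset_insert i x)
  unfold coordDev coordAvg coordDiff
  rw [abs_le]
  constructor <;> nlinarith

/-- A monotone function whose restrictions, obtained by deleting a bounded number of coordinates,
all have expectation bounded below for all biases slightly below `1 / 2`, has expectation close
to `1` at bias `1 / 2`. -/
theorem exists_half_lt_biasedAvg {ζ c : ℝ} (hζ : 0 < ζ) (hζ' : ζ ≤ 1 / 4) (hc : 0 < c) :
    ∃ h : ℕ, ∀ (α : Type) [Fintype α] [DecidableEq α] (f : Finset α → ℝ), Monotone f →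
      (∀ x, f x = 0 ∨ f x = 1) →
      (∀ J : Finset α, J.card ≤ h → ∀ q, 1 / 2 - ζ / 2 ≤ q → q ≤ 1 / 2 →
        c ≤ biasedAvg q Jᶜ f ∅) →
      1 / 2 < biasedAvg (1 / 2) Finset.univ f ∅ := by
  -- `K` is the reciprocal of the length `ζ / 2` of the bias interval. `δ` and `L` give `L δ K = 8K`
  -- and `L c = 64K`, so the error `16K` costs at most 1/4 of measure. At most `K / τ` coordinates
  -- can have influence above `τ`.
  set K : ℝ := 2 / ζ with hK
  have hKp : 0 < K := by positivity
  set δ : ℝ := c / (8 * K) with hδ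
  have hδp : 0 < δ := by positivity
  set L : ℝ := 64 * K / c with hL
  have hLp : 0 < L := by positivity
  set τ : ℝ := δ * Real.exp (-L) with hτ
  have hτp : 0 < τ := by positivity
  refine ⟨⌈K / τ⌉₊, fun α _ _ f hf h01 hJ => ?_⟩
  have hf0 : ∀ x, 0 ≤ f x := fun x => by rcases h01 x with h | h <;> simp [h]
  have hf1 : ∀ x, f x ≤ 1 := fun x => by rcases h01 x with h | h <;> simp [h]
  have hD0 : ∀ i x, 0 ≤ coordDiff i f x := fun i x =>
    sub_nonneg.2 (hf ((Finset.erase_subset i x).trans (Finset.subset_insert i x)))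
  have hD1 : ∀ i x, coordDiff i f x ≤ 1 := fun i x => by
    have := hf0 (x.erase i); have := hf1 (insert i x); unfold coordDiff; linarith
  have hderiv := fun q => hasDerivAt_biasedAvg q Finset.univ f (∅ : Finset α)
  obtain ⟨q, ⟨hq1, hq2⟩, hq⟩ := exists_hasDerivAt_eq_slope
    (fun p => biasedAvg p Finset.univ f (∅ : Finset α)) _
    (show 1 / 2 - ζ / 2 < (1 / 2 : ℝ) by linarith)
    (fun p _ => (hderiv p).continuousAt.continuousWithinAt) (fun p _ => hderiv p)
  have hq0' : 0 ≤ q := by linarith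
  have hq1' : q ≤ 1 := by linarith
  have hmono : biasedAvg q Finset.univ f ∅ ≤ biasedAvg (1 / 2) Finset.univ f ∅ := by
    obtain ⟨p, ⟨hp1, hp2⟩, hp⟩ := exists_hasDerivAt_eq_slope
      (fun p => biasedAvg p Finset.univ f (∅ : Finset α)) _ hq2
      (fun p _ => (hderiv p).continuousAt.continuousWithinAt) (fun p _ => hderiv p)
    have h1 : 0 ≤ ∑ j, biasedAvg p Finset.univ (coordDiff j f) ∅ := Finset.sum_nonneg fun j _ =>
      biasedAvg_nonneg (by linarith) (by linarith) _ (hD0 j) _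
    rw [hp, div_nonneg_iff] at h1
    rcases h1 with h1 | h1
    · linarith [h1.1]
    · linarith [h1.2]
  set I : α → ℝ := fun i => biasedAvg q Finset.univ (coordDiff i f) ∅ with hIdef
  have hI0 : ∀ i, 0 ≤ I i := fun i => biasedAvg_nonneg hq0' hq1' _ (hD0 i) _
  have hIK : ∑ i, I i ≤ K := by
    rw [hIdef, hq, div_le_iff₀ (by linarith)]
    have a1 := biasedAvg_mono (by norm_num : (0:ℝ) ≤ 1 / 2) (by norm_num) Finset.univ hf1 ∅
    have a2 := biasedAvg_nonneg (by linarith : 0 ≤ 1 / 2 - ζ / 2) (by linarith) Finset.univ hf0 ∅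
    rw [biasedAvg_const] at a1
    have e : K * (1 / 2 - (1 / 2 - ζ / 2)) = 1 := by rw [hK]; field_simp; ring
    rw [e]
    linarith
  set J : Finset α := {i | τ < I i} with hJdef
  have hJc : J.card ≤ ⌈K / τ⌉₊ := by
    have h1 : J.card • τ ≤ ∑ i ∈ J, I i :=
      Finset.card_nsmul_le_sum _ _ _ fun i hi => (Finset.mem_filter.1 hi).2.le
    have h2 : ∑ i ∈ J, I i ≤ ∑ i, I i :=
      Finset.sum_le_sum_of_subset_of_nonneg (Finset.subset_univ _) fun i _ _ => hI0 i
    rw [nsmul_eq_mul] at h1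
    have h3 : (J.card : ℝ) ≤ K / τ := by rw [le_div_iff₀ hτp]; linarith
    exact_mod_cast h3.trans (Nat.le_ceil _)
  have hV : ∀ i ∈ Jᶜ, I i ≤ δ * Real.exp (-L) := fun i hi => by
    simpa [hJdef] using hi
  have hdev : ∀ i, biasedAvg q Finset.univ (fun y => |coordDev q i f y|) ∅ ≤ I i := fun i =>
    biasedAvg_mono hq0' hq1' _ (abs_coordDev_le hq0' hq1' i hf) _
  have main := biasedAvg_sq_sub_le (by linarith) (by linarith) f hδp hLp I hdev Jᶜ hV
  have hs1 : ∑ i ∈ Jᶜ, I i ≤ K := le_trans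
    (Finset.sum_le_sum_of_subset_of_nonneg (Finset.subset_univ _) fun i _ _ => hI0 i) hIK
  have hs2 : ∑ j, (biasedAvg q Finset.univ (fun y => coordDev q j f y ^ 2) ∅ -
      biasedAvg q Finset.univ (fun y => biasedAvg q Jᶜ (coordDev q j f) y ^ 2) ∅) ≤ K := by
    refine le_trans (Finset.sum_le_sum fun j _ => ?_) hIK
    have a1 := biasedAvg_nonneg hq0' hq1' Finset.univ
      (f := fun y => biasedAvg q Jᶜ (coordDev q j f) y ^ 2) (fun _ => sq_nonneg _) ∅
    have a2 : biasedAvg q Finset.univ (fun y => coordDev q j f y ^ 2) ∅ ≤ I j := by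
      refine biasedAvg_mono hq0' hq1' _ (fun y => ?_) _
      have b1 := abs_coordDev_le hq0' hq1' j hf y
      have b2 := hD1 j y
      rw [← sq_abs]
      nlinarith [abs_nonneg (coordDev q j f y)]
    linarith
  set a := biasedAvg q Jᶜ f with ha
  have hfsq : (fun y => f y ^ 2) = f := by
    ext y; rcases h01 y with h | h <;> simp [h]
  have hac : ∀ x, c ≤ a x := by
    intro x
    refine (hJ J hJc q hq1.le hq2.le).trans ?_
    have := sub_nonneg.2 hq1'
    refine Finset.sum_le_sum fun y _ => mul_le_mul_of_nonneg_left (hf ?_) (by positivity)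
    exact Finset.union_subset_union_right
      (Finset.sdiff_subset_sdiff (Finset.empty_subset _) le_rfl)
  have ha1 : ∀ x, a x ≤ 1 := fun x => by
    simpa only [biasedAvg_const] using biasedAvg_mono hq0' hq1' Jᶜ hf1 x
  -- Since `c ≤ a ≤ 1`, pointwise `a - a² ≥ c(1 - a)`: small variance over `Jᶜ` forces the mean up
  -- to 1, not down to 0.
  have hfin : c * (1 - biasedAvg q Finset.univ f ∅) ≤
      biasedAvg q Finset.univ f ∅ - biasedAvg q Finset.univ (fun y => a y ^ 2) ∅ := by
    have b := biasedAvg_mono hq0' hq1' Finset.univ (f := fun y => c * (1 - a y))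
      (g := fun y => a y - a y ^ 2) (fun y => by nlinarith [hac y, ha1 y]) ∅
    rw [biasedAvg_const_mul, biasedAvg_sub, biasedAvg_sub, biasedAvg_const, ha,
      biasedAvg_univ_biasedAvg] at b
    exact b
  rw [hfsq] at main
  have e1 : L * δ * K = 8 * K := by rw [hL, hδ]; field_simp; ring
  have e2 : L * c = 64 * K := by rw [hL]; field_simp
  have e3 : L * δ * ∑ i ∈ Jᶜ, I i ≤ L * δ * K := mul_le_mul_of_nonneg_left hs1 (by positivity)
  have e4 : L * (c * (1 - biasedAvg q Finset.univ f ∅)) ≤ 16 * K :=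
    (mul_le_mul_of_nonneg_left hfin hLp.le).trans (by linarith)
  have e5 : 64 * K * (1 - biasedAvg q Finset.univ f ∅) ≤ 16 * K := by
    rw [← e2]; linarith
  have e6 : 1 - biasedAvg q Finset.univ f ∅ ≤ 1 / 4 := by
    by_contra h
    push Not at h
    nlinarith
  linarith

end BiasedCube

/-! ### From uniform families to biased measure. -/

section Transfer

variable {α : Type*} [DecidableEq α]

/-- The normalized size of a uniform family is at most that of its upper shadow at a
higher level. -/
theorem mul_choose_le_card_upperShadow {W : Finset α} {k l : ℕ} (hkl : k ≤ l)
    {𝒜 : Finset (Finset α)} (h𝒜 : 𝒜 ⊆ Finset.powersetCard k W) {c : ℝ}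
    (hc : c * (W.card.choose k : ℝ) ≤ 𝒜.card) :
    c * (W.card.choose l : ℝ) ≤
      ({y ∈ Finset.powersetCard l W | ∃ x ∈ 𝒜, x ⊆ y}.card : ℝ) := by
  -- Double counting of the inclusions `x ⊆ y`.
  have h1 : 𝒜.card * (W.card - k).choose (l - k) ≤
      {y ∈ Finset.powersetCard l W | ∃ x ∈ 𝒜, x ⊆ y}.card * l.choose k := by
    refine Finset.card_mul_le_card_mul (fun x y : Finset α => x ⊆ y) (fun x hx => ?_)
      (fun y hy => ?_)
    · obtain ⟨hxW, hxk⟩ := Finset.mem_powersetCard.1 (h𝒜 hx)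
      rw [← hxk, ← Finset.card_sdiff_of_subset hxW, ← Finset.card_powersetCard]
      refine Finset.card_le_card_of_injOn (fun z => x ∪ z) (fun z hz => ?_) ?_
      · obtain ⟨hz1, hz2⟩ := Finset.mem_powersetCard.1 hz
        have hd : Disjoint x z :=
          Finset.disjoint_of_subset_right hz1 Finset.disjoint_sdiff
        refine Finset.mem_filter.2 ⟨Finset.mem_filter.2 ⟨Finset.mem_powersetCard.2
          ⟨Finset.union_subset hxW (hz1.trans Finset.sdiff_subset), ?_⟩,
          x, hx, Finset.subset_union_left⟩, Finset.subset_union_left⟩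
        rw [Finset.card_union_of_disjoint hd, hz2]
        omega
      · intro z hz z' hz' h
        have hd : ∀ z ∈ Finset.powersetCard (l - x.card) (W \ x), (x ∪ z) \ x = z := by
          intro z hz
          have hd : Disjoint x z := Finset.disjoint_of_subset_right
            (Finset.mem_powersetCard.1 hz).1 Finset.disjoint_sdiff
          exact Finset.union_sdiff_cancel_left hd
        rw [← hd z hz, ← hd z' hz']
        simp only at h
        rw [h]
    · obtain ⟨hyW, hyl⟩ := Finset.mem_powersetCard.1 (Finset.mem_filter.1 hy).1
      rw [← hyl, ← Finset.card_powersetCard]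
      refine Finset.card_le_card fun x hx => ?_
      obtain ⟨hx1, hx2⟩ := Finset.mem_filter.1 hx
      exact Finset.mem_powersetCard.2 ⟨hx2, (Finset.mem_powersetCard.1 (h𝒜 hx1)).2⟩
  have h2 : W.card.choose l * l.choose k = W.card.choose k * (W.card - k).choose (l - k) :=
    Nat.choose_mul hkl
  have h1' : (𝒜.card : ℝ) * ((W.card - k).choose (l - k) : ℝ) ≤
      ({y ∈ Finset.powersetCard l W | ∃ x ∈ 𝒜, x ⊆ y}.card : ℝ) * (l.choose k : ℝ) := by
    exact_mod_cast h1
  have h2' : (W.card.choose l : ℝ) * (l.choose k : ℝ) =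
      (W.card.choose k : ℝ) * ((W.card - k).choose (l - k) : ℝ) := by exact_mod_cast h2
  have hpos : (0 : ℝ) < l.choose k := by exact_mod_cast Nat.choose_pos hkl
  refine le_of_mul_le_mul_right ?_ hpos
  rw [mul_assoc, h2', ← mul_assoc]
  exact (mul_le_mul_of_nonneg_right hc (Nat.cast_nonneg _)).trans h1'

/-- Chebyshev's inequality for the lower tail of the binomial distribution. -/
theorem binomial_lowerTail_le {q : ℝ} (h0 : 0 ≤ q) (h1 : q ≤ 1) (m k : ℕ) {s : ℝ} (hs : 0 < s)
    (hk : (k : ℝ) + s ≤ q * m) :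
    s ^ 2 * ∑ l ∈ Finset.range (m + 1) with ¬ k ≤ l, (m.choose l : ℝ) * (q ^ l * (1 - q) ^ (m - l)) ≤
      m / 4 := by
  have hq := sub_nonneg.2 h1
  have hv := congrArg (Polynomial.eval q) (bernsteinPolynomial.variance ℝ m)
  simp only [bernsteinPolynomial, Polynomial.eval_finsetSum, Polynomial.eval_mul,
    Polynomial.eval_pow, Polynomial.eval_sub, Polynomial.eval_X, Polynomial.eval_one,
    Polynomial.eval_natCast, nsmul_eq_mul] at hv
  have hle : s ^ 2 * ∑ l ∈ Finset.range (m + 1) with ¬ k ≤ l,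
      (m.choose l : ℝ) * (q ^ l * (1 - q) ^ (m - l)) ≤
      ∑ l ∈ Finset.range (m + 1), (m * q - l) ^ 2 * (m.choose l * q ^ l * (1 - q) ^ (m - l)) := by
    rw [Finset.mul_sum]
    refine le_trans (Finset.sum_le_sum fun l hl => ?_)
      (Finset.sum_le_sum_of_subset_of_nonneg (Finset.filter_subset _ _)
        fun l _ _ => by positivity)
    rw [← mul_assoc (m.choose l : ℝ)]
    refine mul_le_mul_of_nonneg_right ?_ (by positivity)
    have hlk : (l : ℝ) ≤ k := by
      exact_mod_cast (not_le.1 (Finset.mem_filter.1 hl).2).le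
    exact pow_le_pow_left₀ hs.le (by linarith) 2
  rw [hv] at hle
  refine hle.trans ?_
  have hm : (0 : ℝ) ≤ m := Nat.cast_nonneg m
  nlinarith [mul_nonneg hm (sq_nonneg (q - 1 / 2))]

/-- A dense uniform family has a dense up-closure with respect to the biased measure, if the bias
exceeds the normalized set size. -/
theorem half_mul_le_biasedAvg {q : ℝ} (h0 : 0 ≤ q) (h1 : q ≤ 1) {W : Finset α} {k : ℕ}
    {𝒜 : Finset (Finset α)} (h𝒜 : 𝒜 ⊆ Finset.powersetCard k W) {c : ℝ} (hc0 : 0 ≤ c)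
    (hc : c * (W.card.choose k : ℝ) ≤ 𝒜.card) {s : ℝ} (hs : 0 < s)
    (hk : (k : ℝ) + s ≤ q * W.card) (hm : (W.card : ℝ) ≤ 2 * s ^ 2) {f : Finset α → ℝ}
    (hf0 : ∀ y, 0 ≤ f y) (hf : ∀ y ⊆ W, ∀ x ∈ 𝒜, x ⊆ y → 1 ≤ f y) :
    c / 2 ≤ biasedAvg q W f ∅ := by
  have hq := sub_nonneg.2 h1
  set m := W.card with hmdef
  have hlevel : ∀ l, k ≤ l → c * ((m.choose l : ℝ) * (q ^ l * (1 - q) ^ (m - l))) ≤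
      ∑ y ∈ Finset.powersetCard l W, q ^ y.card * (1 - q) ^ (m - y.card) * f (y ∪ (∅ \ W)) := by
    intro l hl
    have h2 := mul_choose_le_card_upperShadow hl h𝒜 hc
    calc c * ((m.choose l : ℝ) * (q ^ l * (1 - q) ^ (m - l)))
        = c * (m.choose l : ℝ) * (q ^ l * (1 - q) ^ (m - l)) := by ring
      _ ≤ ({y ∈ Finset.powersetCard l W | ∃ x ∈ 𝒜, x ⊆ y}.card : ℝ) *
          (q ^ l * (1 - q) ^ (m - l)) := mul_le_mul_of_nonneg_right h2 (by positivity)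
      _ = ∑ y ∈ Finset.powersetCard l W with ∃ x ∈ 𝒜, x ⊆ y, q ^ l * (1 - q) ^ (m - l) := by
          rw [Finset.sum_const, nsmul_eq_mul]
      _ ≤ ∑ y ∈ Finset.powersetCard l W with ∃ x ∈ 𝒜, x ⊆ y,
          q ^ y.card * (1 - q) ^ (m - y.card) * f (y ∪ (∅ \ W)) := by
          refine Finset.sum_le_sum fun y hy => ?_
          obtain ⟨hy1, x, hx, hxy⟩ := Finset.mem_filter.1 hy
          obtain ⟨hyW, hyl⟩ := Finset.mem_powersetCard.1 hy1
          rw [hyl, Finset.empty_sdiff, Finset.union_empty]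
          exact le_mul_of_one_le_right (by positivity) (hf y hyW x hx hxy)
      _ ≤ _ := Finset.sum_le_sum_of_subset_of_nonneg (Finset.filter_subset _ _)
          fun y _ _ => mul_nonneg (by positivity) (hf0 _)
  have hsum : c * ∑ l ∈ Finset.range (m + 1) with k ≤ l,
      (m.choose l : ℝ) * (q ^ l * (1 - q) ^ (m - l)) ≤ biasedAvg q W f ∅ := by
    rw [biasedAvg, Finset.sum_powerset, Finset.mul_sum]
    refine le_trans (Finset.sum_le_sum fun l hl => hlevel l (Finset.mem_filter.1 hl).2)
      (Finset.sum_le_sum_of_subset_of_nonneg (Finset.filter_subset _ _) fun l _ _ => ?_)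
    exact Finset.sum_nonneg fun y _ => mul_nonneg (by positivity) (hf0 _)
  have htot : ∑ l ∈ Finset.range (m + 1), (m.choose l : ℝ) * (q ^ l * (1 - q) ^ (m - l)) = 1 := by
    have := add_pow q (1 - q) m
    rw [add_sub_cancel, one_pow] at this
    exact Eq.trans (Finset.sum_congr rfl fun l _ => by ring) this.symm
  rw [← Finset.sum_filter_add_sum_filter_not _ (fun l => k ≤ l)] at htot
  have hcheb := binomial_lowerTail_le h0 h1 m k hs hk
  -- The hypothesis `m ≤ 2s²` makes the Chebyshev bound at most 1/2, so at least half of the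
  -- binomial mass sits on levels `l ≥ k`.
  have htail : ∑ l ∈ Finset.range (m + 1) with ¬ k ≤ l,
      (m.choose l : ℝ) * (q ^ l * (1 - q) ^ (m - l)) ≤ 1 / 2 := by
    have hs2 : 0 < s ^ 2 := by positivity
    refine le_of_mul_le_mul_left (hcheb.trans ?_) hs2
    linarith
  nlinarith

end Transfer

/-! ### Slices and the potential argument. -/

section Slices

variable {α : Type*} [DecidableEq α]

/-- The number of members of `𝒮` whose trace on `J` is `B`. -/
def sliceCard (𝒮 : Finset (Finset α)) (J B : Finset α) : ℕ := {x ∈ 𝒮 | x ∩ J = B}.card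

theorem sliceCard_mono {𝒮 𝒯 : Finset (Finset α)} (h : 𝒮 ⊆ 𝒯) (J B : Finset α) :
    sliceCard 𝒮 J B ≤ sliceCard 𝒯 J B :=
  Finset.card_le_card (Finset.filter_subset_filter _ h)

theorem sliceCard_eq_sum (𝒮 : Finset (Finset α)) {J J' : Finset α} (hJ : J ⊆ J') (B : Finset α) :
    (sliceCard 𝒮 J B : ℝ) = ∑ B' ∈ J'.powerset with B' ∩ J = B, (sliceCard 𝒮 J' B' : ℝ) := by
  rw [sliceCard, Finset.card_eq_sum_card_fiberwise (f := fun x => x ∩ J')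
    (t := J'.powerset.filter fun B' => B' ∩ J = B), Nat.cast_sum]
  · refine Finset.sum_congr rfl fun B' hB' => ?_
    congr 2
    ext x
    simp only [Finset.mem_filter]
    constructor
    · rintro ⟨⟨h1, -⟩, h2⟩
      exact ⟨h1, h2⟩
    · rintro ⟨h1, h2⟩
      refine ⟨⟨h1, ?_⟩, h2⟩
      rw [← (Finset.mem_filter.1 hB').2, ← h2, Finset.inter_assoc, Finset.inter_eq_right.2 hJ]
  · intro x hx
    have hx' := (Finset.mem_filter.1 (Finset.mem_coe.1 hx)).2
    refine Finset.mem_coe.2 (Finset.mem_filter.2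
      ⟨Finset.mem_powerset.2 Finset.inter_subset_right, ?_⟩)
    rw [Finset.inter_assoc, Finset.inter_eq_right.2 hJ, hx']

theorem sum_sliceCard (𝒮 : Finset (Finset α)) (J : Finset α) :
    ∑ B ∈ J.powerset, (sliceCard 𝒮 J B : ℝ) = 𝒮.card := by
  have h := sliceCard_eq_sum 𝒮 (Finset.empty_subset J) ∅
  simp only [Finset.inter_empty, Finset.filter_true] at h
  rw [← h, sliceCard]
  simp

/-- Each Pascal step keeps a fraction `r/m` (element taken, counted by `s`) or `(m - r)/m` (not
taken). The two hypotheses, with their slack `a`, keep both at least `z` for `a` steps. -/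
theorem pow_mul_choose_le {z : ℝ} (hz : 0 ≤ z) (a : ℕ) : ∀ s m r : ℕ, s ≤ a →
    z * m ≤ (r : ℝ) - a → (r : ℝ) + z * m ≤ m - a →
    z ^ a * (m.choose r : ℝ) ≤ ((m - a).choose (r - s) : ℝ) := by
  induction a with
  | zero => intro s m r hs _ _; simp [Nat.le_zero.1 hs]
  | succ a ih =>
    intro s m r hs h1 h2
    push_cast at h1 h2
    have hzm : 0 ≤ z * m := by positivity
    have hr0 : (0 : ℝ) ≤ r := Nat.cast_nonneg r
    have ha0 : (0 : ℝ) ≤ a := Nat.cast_nonneg a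
    have hr1 : (1 : ℝ) ≤ r := by linarith
    have hm1 : (1 : ℝ) ≤ m := by linarith
    obtain ⟨r, rfl⟩ := Nat.exists_eq_add_of_le' (show 1 ≤ r by exact_mod_cast hr1)
    obtain ⟨m, rfl⟩ := Nat.exists_eq_add_of_le' (show 1 ≤ m by exact_mod_cast hm1)
    have hmpos : (0 : ℝ) < ((m + 1 : ℕ) : ℝ) := by positivity
    have e1 : ((m + 1 : ℕ) : ℝ) * (m.choose r : ℝ) =
        ((m + 1).choose (r + 1) : ℝ) * ((r + 1 : ℕ) : ℝ) := by
      exact_mod_cast Nat.add_one_mul_choose_eq m r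
    have e2 : ((m + 1).choose (r + 1) : ℝ) = (m.choose r : ℝ) + (m.choose (r + 1) : ℝ) := by
      exact_mod_cast Nat.choose_succ_succ m r
    have hC : (0 : ℝ) ≤ ((m + 1).choose (r + 1) : ℝ) := Nat.cast_nonneg _
    rw [pow_succ, mul_assoc]
    have hza : 0 ≤ z ^ a := by positivity
    push_cast at h1 h2 e1 hmpos
    rcases s with _ | s
    · have h3 : z * ((m + 1).choose (r + 1) : ℝ) ≤ (m.choose (r + 1) : ℝ) := by
        refine le_of_mul_le_mul_left ?_ hmpos
        nlinarith
      have h4 := ih 0 m (r + 1) (Nat.zero_le _) (by push_cast; nlinarith) (by push_cast; nlinarith)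
      rw [Nat.add_sub_add_right]
      exact (mul_le_mul_of_nonneg_left h3 hza).trans h4
    · have h3 : z * ((m + 1).choose (r + 1) : ℝ) ≤ (m.choose r : ℝ) := by
        refine le_of_mul_le_mul_left ?_ hmpos
        nlinarith
      have h4 := ih s m r (by omega) (by nlinarith) (by nlinarith)
      rw [Nat.add_sub_add_right, Nat.add_sub_add_right]
      exact (mul_le_mul_of_nonneg_left h3 hza).trans h4

variable [Fintype α]

theorem sliceCard_powersetCard {k : ℕ} {J B : Finset α} (hB : B ⊆ J) (hk : B.card ≤ k) :
    sliceCard (Finset.powersetCard k Finset.univ) J B =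
      (Fintype.card α - J.card).choose (k - B.card) := by
  rw [← Finset.card_compl, ← Finset.card_powersetCard, sliceCard]
  symm
  refine Finset.card_bij' (fun z _ => B ∪ z) (fun x _ => x \ J) (fun z hz => ?_) (fun x hx => ?_)
    (fun z hz => ?_) (fun x hx => ?_)
  · obtain ⟨hz1, hz2⟩ := Finset.mem_powersetCard.1 hz
    have hd : Disjoint z J := Finset.subset_compl_iff_disjoint_right.1 hz1
    refine Finset.mem_filter.2 ⟨Finset.mem_powersetCard.2 ⟨Finset.subset_univ _, ?_⟩, ?_⟩
    · rw [Finset.card_union_of_disjoint (hd.symm.mono_left hB), hz2]; omega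
    · rw [Finset.union_inter_distrib_right, Finset.inter_eq_left.2 hB,
        Finset.disjoint_iff_inter_eq_empty.1 hd, Finset.union_empty]
  · obtain ⟨hx1, hx2⟩ := Finset.mem_filter.1 hx
    have hxk := (Finset.mem_powersetCard.1 hx1).2
    refine Finset.mem_powersetCard.2 ⟨fun a ha => Finset.mem_compl.2 (Finset.mem_sdiff.1 ha).2, ?_⟩
    have := Finset.card_sdiff_add_card_inter x J
    rw [hx2] at this
    omega
  · obtain ⟨hz1, hz2⟩ := Finset.mem_powersetCard.1 hz
    have hd : Disjoint z J := Finset.subset_compl_iff_disjoint_right.1 hz1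
    rw [Finset.union_sdiff_distrib, Finset.sdiff_eq_empty_iff_subset.2 hB, Finset.empty_union,
      Finset.sdiff_eq_self_of_disjoint hd]
  · rw [← (Finset.mem_filter.1 hx).2, Finset.union_comm, Finset.sdiff_union_inter]

/-- As `k/n` stays away from 0 and 1, each fixed coordinate retains a fraction at least `ζ / 2` of
the slice. -/
theorem pow_mul_sliceCard_le {ζ : ℝ} (hζ : 0 < ζ) (hζ' : ζ ≤ 1 / 4) {k M h : ℕ}
    (hk1 : ζ * (Fintype.card α : ℝ) ≤ k) (hk2 : (k : ℝ) ≤ (1 / 2 - ζ) * (Fintype.card α : ℝ))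
    (hn : 2 * ((M : ℝ) + h) ≤ ζ * (Fintype.card α : ℝ)) {J J' B S : Finset α} (hJ : J.card ≤ M)
    (hJ' : J'.card ≤ h) (hd : Disjoint J J') (hB : B ⊆ J) (hS : S ⊆ J') :
    (ζ / 2) ^ h * (sliceCard (Finset.powersetCard k Finset.univ) J B : ℝ) ≤
      (sliceCard (Finset.powersetCard k Finset.univ) (J ∪ J') (B ∪ S) : ℝ) := by
  have hBc := Finset.card_le_card hB
  have hSc := Finset.card_le_card hS
  have hn0 : (0 : ℝ) ≤ Fintype.card α := Nat.cast_nonneg _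
  have hMhk : M + h ≤ k := by
    have : (M : ℝ) + h ≤ k := by
      have : (0 : ℝ) ≤ (M : ℝ) + h := by positivity
      linarith
    exact_mod_cast this
  have hBS : (B ∪ S).card = B.card + S.card :=
    Finset.card_union_of_disjoint (Finset.disjoint_of_subset_left hB
      (Finset.disjoint_of_subset_right hS hd))
  have hkn : k ≤ Fintype.card α := by
    have : (k : ℝ) ≤ Fintype.card α := by nlinarith
    exact_mod_cast this
  rw [sliceCard_powersetCard hB (by omega), sliceCard_powersetCard
    (Finset.union_subset_union hB hS) (by omega), hBS, Finset.card_union_of_disjoint hd,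
    Nat.sub_add_eq, Nat.sub_add_eq]
  have hJ1 : (J.card : ℝ) ≤ M := by exact_mod_cast hJ
  have hJ1' : (J'.card : ℝ) ≤ h := by exact_mod_cast hJ'
  have hB1 : (B.card : ℝ) ≤ M := by exact_mod_cast hBc.trans hJ
  have hJ0 : (0 : ℝ) ≤ J.card := Nat.cast_nonneg _
  have hB0 : (0 : ℝ) ≤ B.card := Nat.cast_nonneg _
  refine le_trans ?_ (pow_mul_choose_le (z := ζ / 2) (by positivity) J'.card S.card _ _ hSc ?_ ?_)
  · exact mul_le_mul_of_nonneg_right (pow_le_pow_of_le_one (by positivity) (by linarith) hJ')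
      (Nat.cast_nonneg _)
  · rw [Nat.cast_sub (by omega), Nat.cast_sub (by omega)]
    nlinarith
  · rw [Nat.cast_sub (by omega), Nat.cast_sub (by omega)]
    nlinarith

/-- The slice of `ℱ` at `B ⊆ J` is dense, and remains so after fixing at most `h` further
coordinates. -/
def IsRobustSlice (k h : ℕ) (c : ℝ) (ℱ : Finset (Finset α)) (J B : Finset α) : Prop :=
  c * (sliceCard (Finset.powersetCard k Finset.univ) J B : ℝ) ≤ sliceCard ℱ J B ∧
    ∀ J' S : Finset α, J'.card ≤ h → Disjoint J J' → S ⊆ J' →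
      c / 2 * (sliceCard (Finset.powersetCard k Finset.univ) (J ∪ J') (B ∪ S) : ℝ) ≤
        sliceCard ℱ (J ∪ J') (B ∪ S)

/-- The potential used to find a set of coordinates with mostly robust slices. -/
def slicePotential (k : ℕ) (c : ℝ) (ℱ : Finset (Finset α)) (J : Finset α) : ℝ :=
  ∑ B ∈ J.powerset, min (sliceCard ℱ J B : ℝ)
    (c * (sliceCard (Finset.powersetCard k Finset.univ) J B : ℝ))

theorem slicePotential_empty_le (k : ℕ) (c : ℝ) (ℱ : Finset (Finset α)) :
    slicePotential k c ℱ ∅ ≤ c * ((Fintype.card α).choose k : ℝ) := by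
  simp [slicePotential, sliceCard]

open Classical in
/-- If many members of `ℱ` lie in slices that are not robust, then fixing boundedly many more
coordinates decreases the potential. -/
theorem exists_slicePotential_le {ζ : ℝ} (hζ : 0 < ζ) (hζ' : ζ ≤ 1 / 4) {k M h : ℕ}
    (hk1 : ζ * (Fintype.card α : ℝ) ≤ k) (hk2 : (k : ℝ) ≤ (1 / 2 - ζ) * (Fintype.card α : ℝ))
    (hn : 2 * ((M : ℝ) + h) ≤ ζ * (Fintype.card α : ℝ)) {c : ℝ} (hc : 0 < c)
    {ℱ : Finset (Finset α)} (hℱ : ℱ ⊆ Finset.powersetCard k Finset.univ) {J : Finset α}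
    (hJ : J.card ≤ M)
    (hbad : 2 * c * ((Fintype.card α).choose k : ℝ) ≤
      ∑ B ∈ J.powerset with ¬ IsRobustSlice k h c ℱ J B, (sliceCard ℱ J B : ℝ)) :
    ∃ J₁ : Finset α, J₁.card ≤ J.card + 2 ^ J.card * h ∧
      slicePotential k c ℱ J₁ ≤ slicePotential k c ℱ J -
        c / 2 * (ζ / 2) ^ h * c * ((Fintype.card α).choose k : ℝ) := by
  set 𝒰 : Finset (Finset α) := Finset.powersetCard k Finset.univ with h𝒰
  have h𝒰c : (𝒰.card : ℝ) = ((Fintype.card α).choose k : ℝ) := by simp [h𝒰]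
  set bad : Finset α → Prop := fun B =>
    ¬ IsRobustSlice k h c ℱ J B ∧ c * (sliceCard 𝒰 J B : ℝ) ≤ sliceCard ℱ J B with hbaddef
  have hex : ∀ B, ∃ J' S : Finset α, J'.card ≤ h ∧ Disjoint J J' ∧ S ⊆ J' ∧
      (bad B → (sliceCard ℱ (J ∪ J') (B ∪ S) : ℝ) < c / 2 * sliceCard 𝒰 (J ∪ J') (B ∪ S)) := by
    intro B
    by_cases hB : bad B
    · have h1 := hB.1
      unfold IsRobustSlice at h1
      push Not at h1
      obtain ⟨J', S, a1, a2, a3, a4⟩ := h1 hB.2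
      exact ⟨J', S, a1, a2, a3, fun _ => a4⟩
    · exact ⟨∅, ∅, by simp, by simp, by simp, fun h => absurd h hB⟩
  choose J' S hJ'c hJ'd hS hlt using hex
  -- All witnesses of non-robustness are adjoined at once, at most `h` points for each of the `2 ^
  -- J.card` traces.
  set J₁ := J ∪ J.powerset.biUnion J' with hJ₁
  have hJJ₁ : J ⊆ J₁ := Finset.subset_union_left
  refine ⟨J₁, ?_, ?_⟩
  · refine (Finset.card_union_le _ _).trans (Nat.add_le_add_left ?_ _)
    rw [← Finset.card_powerset]
    exact Finset.card_biUnion_le_card_mul _ _ _ fun B _ => hJ'c B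
  -- Refinement never raises the capped count. In a bad slice the cap `c` was attained, while the
  -- witness subslice has density below `c / 2`, saving `c / 2` times its size.
  have hfib : ∀ B ∈ J.powerset,
      ∑ B₁ ∈ J₁.powerset with B₁ ∩ J = B, min (sliceCard ℱ J₁ B₁ : ℝ) (c * sliceCard 𝒰 J₁ B₁) ≤
      min (sliceCard ℱ J B : ℝ) (c * sliceCard 𝒰 J B) -
        if bad B then c / 2 * (ζ / 2) ^ h * sliceCard 𝒰 J B else 0 := by
    intro B hB
    have hBJ := Finset.mem_powerset.1 hB
    split_ifs with hb
    · rw [min_eq_right hb.2]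
      have hJ2 : J ∪ J' B ⊆ J₁ :=
        Finset.union_subset_union_right (Finset.subset_biUnion_of_mem J' hB)
      have hset : {B₁ ∈ J₁.powerset.filter (fun B₁ => B₁ ∩ J = B) |
          B₁ ∩ (J ∪ J' B) = B ∪ S B} = J₁.powerset.filter fun B₁ =>
            B₁ ∩ (J ∪ J' B) = B ∪ S B := by
        ext B₁
        simp only [Finset.mem_filter]
        constructor
        · rintro ⟨⟨a1, -⟩, a2⟩; exact ⟨a1, a2⟩
        · rintro ⟨a1, a2⟩
          refine ⟨⟨a1, ?_⟩, a2⟩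
          have : B₁ ∩ J = (B₁ ∩ (J ∪ J' B)) ∩ J := by
            rw [Finset.inter_assoc, Finset.inter_eq_right.2 Finset.subset_union_left]
          rw [this, a2, Finset.union_inter_distrib_right, Finset.inter_eq_left.2 hBJ,
            Finset.disjoint_iff_inter_eq_empty.1
              (Finset.disjoint_of_subset_left (hS B) (hJ'd B).symm), Finset.union_empty]
      rw [← Finset.sum_filter_add_sum_filter_not _ (fun B₁ => B₁ ∩ (J ∪ J' B) = B ∪ S B), hset]
      have s1 : ∑ B₁ ∈ J₁.powerset with B₁ ∩ (J ∪ J' B) = B ∪ S B,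
          min (sliceCard ℱ J₁ B₁ : ℝ) (c * sliceCard 𝒰 J₁ B₁) ≤
          sliceCard ℱ (J ∪ J' B) (B ∪ S B) := by
        rw [sliceCard_eq_sum ℱ hJ2]
        exact Finset.sum_le_sum fun _ _ => min_le_left _ _
      have s2 := Finset.sum_le_sum (s := {B₁ ∈ J₁.powerset.filter (fun B₁ => B₁ ∩ J = B) |
          ¬ B₁ ∩ (J ∪ J' B) = B ∪ S B}) fun B₁ _ =>
        min_le_right (sliceCard ℱ J₁ B₁ : ℝ) (c * sliceCard 𝒰 J₁ B₁)
      rw [← Finset.mul_sum] at s2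
      have s3 := sliceCard_eq_sum 𝒰 hJJ₁ B
      rw [← Finset.sum_filter_add_sum_filter_not _ (fun B₁ => B₁ ∩ (J ∪ J' B) = B ∪ S B), hset,
        ← sliceCard_eq_sum 𝒰 hJ2] at s3
      have s4 := pow_mul_sliceCard_le hζ hζ' hk1 hk2 hn hJ (hJ'c B) (hJ'd B) hBJ (hS B)
      have s5 := hlt B hb
      have s6 := mul_le_mul_of_nonneg_left s4 (by positivity : 0 ≤ c / 2)
      rw [← h𝒰] at s6
      rw [s3] at s6 ⊢
      linarith
    · rw [sub_zero]
      refine le_min ?_ ?_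
      · rw [sliceCard_eq_sum ℱ hJJ₁]
        exact Finset.sum_le_sum fun _ _ => min_le_left _ _
      · rw [sliceCard_eq_sum 𝒰 hJJ₁, Finset.mul_sum]
        exact Finset.sum_le_sum fun _ _ => min_le_right _ _
  have hsum := Finset.sum_le_sum hfib
  rw [Finset.sum_fiberwise_of_maps_to (g := fun B₁ => B₁ ∩ J)
    (fun B₁ _ => Finset.mem_powerset.2 Finset.inter_subset_right),
    Finset.sum_sub_distrib, ← Finset.sum_filter, ← Finset.mul_sum] at hsum
  -- Non-robust slices of density below `c` hold at most `c * choose` members, so half of the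
  -- assumed mass lies in bad slices.
  have hbadN : c * ((Fintype.card α).choose k : ℝ) ≤
      ∑ B ∈ J.powerset with bad B, (sliceCard 𝒰 J B : ℝ) := by
    rw [← Finset.sum_filter_add_sum_filter_not _
      (fun B => c * (sliceCard 𝒰 J B : ℝ) ≤ sliceCard ℱ J B), Finset.filter_filter] at hbad
    have t1 : ∑ B ∈ J.powerset with bad B, (sliceCard ℱ J B : ℝ) ≤
        ∑ B ∈ J.powerset with bad B, (sliceCard 𝒰 J B : ℝ) :=
      Finset.sum_le_sum fun B _ => by exact_mod_cast sliceCard_mono hℱ J B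
    have t2 : ∑ B ∈ (J.powerset.filter fun B => ¬ IsRobustSlice k h c ℱ J B) with
        ¬ c * (sliceCard 𝒰 J B : ℝ) ≤ sliceCard ℱ J B, (sliceCard ℱ J B : ℝ) ≤
        c * ((Fintype.card α).choose k : ℝ) := by
      rw [← h𝒰c, ← sum_sliceCard 𝒰 J, Finset.mul_sum]
      refine le_trans (Finset.sum_le_sum fun B hB => (not_le.1 (Finset.mem_filter.1 hB).2).le) ?_
      exact Finset.sum_le_sum_of_subset_of_nonneg
        ((Finset.filter_subset _ _).trans (Finset.filter_subset _ _))
        fun B _ _ => by positivity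
    linarith
  have := mul_le_mul_of_nonneg_left hbadN (by positivity : 0 ≤ c / 2 * (ζ / 2) ^ h)
  unfold slicePotential
  rw [← h𝒰]
  linarith

open Classical in
/-- Every uniform family admits a bounded set of coordinates such that all but few of its members
lie in robust slices. -/
theorem exists_robust_slices {ζ c : ℝ} (hζ : 0 < ζ) (hζ' : ζ ≤ 1 / 4) (hc : 0 < c) (h : ℕ) :
    ∃ M : ℕ, ∀ (α : Type) [Fintype α] [DecidableEq α] (k : ℕ),
      ζ * (Fintype.card α : ℝ) ≤ k → (k : ℝ) ≤ (1 / 2 - ζ) * (Fintype.card α : ℝ) →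
      2 * ((M : ℝ) + h) ≤ ζ * (Fintype.card α : ℝ) →
      ∀ ℱ : Finset (Finset α), ℱ ⊆ Finset.powersetCard k Finset.univ →
      ∃ J : Finset α, J.card ≤ M ∧
        ∑ B ∈ J.powerset with ¬ IsRobustSlice k h c ℱ J B, (sliceCard ℱ J B : ℝ) <
          2 * c * ((Fintype.card α).choose k : ℝ) := by
  set γ : ℝ := c / 2 * (ζ / 2) ^ h * c with hγ
  have hγp : 0 < γ := by positivity
  let Ms : ℕ → ℕ := fun i => Nat.rec 0 (fun _ m => m + 2 ^ m * h) i
  have hMs : Monotone Ms := monotone_nat_of_le_succ fun i => Nat.le_add_right _ _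
  -- The potential starts at most `c * choose`, drops by `γ * choose` per round and is nonnegative,
  -- so `T > c / γ` rounds are impossible.
  obtain ⟨T, hT⟩ := exists_nat_gt (c / γ)
  rw [div_lt_iff₀ hγp] at hT
  refine ⟨Ms T, fun α _ _ k hk1 hk2 hn ℱ hℱ => ?_⟩
  by_contra! hcon
  have hC : (0 : ℝ) < (Fintype.card α).choose k := by
    have : (k : ℝ) ≤ Fintype.card α := by
      have : (0 : ℝ) ≤ Fintype.card α := Nat.cast_nonneg _
      nlinarith
    exact_mod_cast Nat.choose_pos (by exact_mod_cast this)
  have key : ∀ i ≤ T, ∃ J : Finset α, J.card ≤ Ms i ∧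
      slicePotential k c ℱ J ≤ (c - i * γ) * ((Fintype.card α).choose k : ℝ) := by
    intro i
    induction i with
    | zero => exact fun _ => ⟨∅, by simp, by simpa using slicePotential_empty_le k c ℱ⟩
    | succ i ih =>
      intro hi
      obtain ⟨J, hJ1, hJ2⟩ := ih (by omega)
      have hJT := hJ1.trans (hMs (by omega : i ≤ T))
      obtain ⟨J₁, h1, h2⟩ := exists_slicePotential_le hζ hζ' hk1 hk2 hn hc hℱ hJT (hcon J hJT)
      refine ⟨J₁, h1.trans ?_, ?_⟩
      · exact Nat.add_le_add hJ1 (Nat.mul_le_mul_right _ (Nat.pow_le_pow_right (by norm_num) hJ1))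
      · rw [← hγ] at h2
        push_cast
        linarith
  obtain ⟨J, -, hJ⟩ := key T le_rfl
  have h0 : 0 ≤ slicePotential k c ℱ J := Finset.sum_nonneg fun B _ =>
    le_min (Nat.cast_nonneg _) (by positivity)
  nlinarith

end Slices

/-! ### Up-closures of robust slices in the uniform cube. -/

section Assembly

open Classical in
/-- The indicator of the family of sets that contain, outside `J`, some member of `ℱ` with
trace `B` on `J`. -/
noncomputable def upIndicator {α : Type*} [DecidableEq α] (ℱ : Finset (Finset α)) (J B : Finset α)
    (y : Finset α) : ℝ :=
  if ∃ x ∈ ℱ, x ∩ J = B ∧ x \ J ⊆ y then 1 else 0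

theorem upIndicator_monotone {α : Type*} [DecidableEq α] (ℱ : Finset (Finset α))
    (J B : Finset α) : Monotone (upIndicator ℱ J B) := by
  classical
  intro y z hyz
  unfold upIndicator
  split_ifs with h1 h2 h2
  · exact le_rfl
  · obtain ⟨x, hx, h3, h4⟩ := h1
    exact absurd ⟨x, hx, h3, h4.trans hyz⟩ h2
  · norm_num
  · exact le_rfl

theorem upIndicator_eq_zero_or_one {α : Type*} [DecidableEq α] (ℱ : Finset (Finset α))
    (J B y : Finset α) : upIndicator ℱ J B y = 0 ∨ upIndicator ℱ J B y = 1 := by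
  unfold upIndicator
  split_ifs <;> simp

/-- Two functions on the uniform cube with expectations above `1 / 2` are both nonzero at some
pair of complementary points. -/
theorem exists_compl_of_half_lt {α : Type*} [Fintype α] [DecidableEq α] {f g : Finset α → ℝ}
    (hf : ∀ x, f x = 0 ∨ f x = 1) (hg : ∀ x, g x = 0 ∨ g x = 1)
    (hf2 : 1 / 2 < biasedAvg (1 / 2) Finset.univ f ∅)
    (hg2 : 1 / 2 < biasedAvg (1 / 2) Finset.univ g ∅) : ∃ y, f y = 1 ∧ g yᶜ = 1 := by
  have hav : ∀ f : Finset α → ℝ, biasedAvg (1 / 2) Finset.univ f ∅ =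
      (1 / 2) ^ Fintype.card α * ∑ y, f y := by
    intro f
    rw [biasedAvg, Finset.powerset_univ, Finset.mul_sum]
    refine Finset.sum_congr rfl fun y _ => ?_
    rw [show (1 : ℝ) - 1 / 2 = 1 / 2 by norm_num, ← pow_add, Finset.card_univ,
      Nat.add_sub_cancel' (Finset.card_le_univ y), Finset.empty_sdiff, Finset.union_empty]
  by_contra! hcon
  -- Complementation preserves the uniform measure, so without such a pair the two means would sum
  -- to at most 1.
  have hle : ∀ y, f y + g yᶜ ≤ 1 := by
    intro y
    rcases hf y with h | h <;> rcases hg yᶜ with h' | h'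
    · simp [h, h']
    · simp [h, h']
    · simp [h, h']
    · exact absurd h' (hcon y h)
  have hs := Finset.sum_le_sum fun y (_ : y ∈ (Finset.univ : Finset (Finset α))) => hle y
  rw [Finset.sum_add_distrib, Function.Bijective.sum_comp (compl_bijective (α := Finset α)) g,
    Finset.sum_const, Finset.card_univ, Fintype.card_finset, nsmul_eq_mul, mul_one] at hs
  have hm := mul_le_mul_of_nonneg_left hs (by positivity : (0:ℝ) ≤ (1 / 2) ^ Fintype.card α)
  rw [mul_add, ← hav, ← hav, Nat.cast_pow, ← mul_pow] at hm
  norm_num at hm hf2 hg2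
  linarith

/-- The up-closure of a robust slice, further restricted to sets containing a bounded set `S`, has
measure more than `1 / 2` in the uniform cube. -/
theorem exists_half_lt_upIndicator {ζ c : ℝ} (hζ : 0 < ζ) (hζ' : ζ ≤ 1 / 4) (hc : 0 < c) (t : ℕ) :
    ∃ h : ℕ, ∀ (α : Type) [Fintype α] [DecidableEq α] (k M : ℕ),
      ζ * (Fintype.card α : ℝ) ≤ k → (k : ℝ) ≤ (1 / 2 - ζ) * (Fintype.card α : ℝ) →
      2 * ((M : ℝ) + h) ≤ ζ * (Fintype.card α : ℝ) → 8 ≤ ζ ^ 2 * (Fintype.card α : ℝ) →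
      ∀ ℱ : Finset (Finset α), ℱ ⊆ Finset.powersetCard k Finset.univ →
      ∀ J B S : Finset α, J.card ≤ M → B ⊆ J → Disjoint J S → S.card ≤ t →
      IsRobustSlice k h c ℱ J B →
      1 / 2 < biasedAvg (1 / 2) Finset.univ (upIndicator ℱ (J ∪ S) (B ∪ S)) ∅ := by
  obtain ⟨h, hh⟩ := exists_half_lt_biasedAvg hζ hζ' (by positivity : 0 < c / 2 / 2)
  -- Robustness must absorb `S` (at most `t` points) as well as the `h` deleted coordinates.
  refine ⟨h + t, fun α _ _ k M hk1 hk2 hn hn' ℱ hℱ J B S hJ hB hJS hSt hrob => ?_⟩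
  refine hh α _ (upIndicator_monotone _ _ _) (upIndicator_eq_zero_or_one _ _ _)
    fun J' hJ' q hq1 hq2 => ?_
  have hq0 : 0 ≤ q := by linarith
  have hq1' : q ≤ 1 := by linarith
  -- The trace is fixed to `B ∪ S` on `U = J ∪ D`; deleted coordinates outside `J ∪ S` are thus
  -- absent.
  set D : Finset α := (S ∪ J') \ J with hD
  set U : Finset α := J ∪ D with hU
  have hDc : D.card ≤ h + t := by
    refine (Finset.card_le_card Finset.sdiff_subset).trans ((Finset.card_union_le _ _).trans ?_)
    omega
  have hJD : Disjoint J D := Finset.disjoint_sdiff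
  have hSD : S ⊆ D := fun a ha => Finset.mem_sdiff.2
    ⟨Finset.mem_union_left _ ha, fun h => Finset.disjoint_left.1 hJS h ha⟩
  have hUJ' : Uᶜ ⊆ J'ᶜ := by
    refine Finset.compl_subset_compl.2 fun a ha => ?_
    simp only [hU, hD, Finset.mem_union, Finset.mem_sdiff]
    tauto
  refine le_trans ?_ (biasedAvg_le_of_subset hq0 hq1' hUJ' (upIndicator_monotone _ _ _))
  have hBSU : B ∪ S ⊆ U := Finset.union_subset_union hB hSD
  have hUc : U.card ≤ M + (h + t) :=
    (Finset.card_union_le _ _).trans (Nat.add_le_add hJ hDc)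
  have hBSc := Finset.card_le_card hBSU
  have hn0 : (0 : ℝ) ≤ Fintype.card α := Nat.cast_nonneg _
  push_cast at hn
  have hMk : M + (h + t) ≤ k := by
    have : (M : ℝ) + (h + t) ≤ k := by
      have : (0 : ℝ) ≤ (M : ℝ) + (h + t) := by positivity
      linarith
    exact_mod_cast this
  have hdense := hrob.2 D S hDc hJD hSD
  rw [← hU, sliceCard_powersetCard hBSU (by omega), ← Finset.card_compl] at hdense
  set 𝒜 : Finset (Finset α) := {x ∈ ℱ | x ∩ U = B ∪ S}.image (fun x => x \ U) with h𝒜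
  have hxcard : ∀ x ∈ ℱ, x ∩ U = B ∪ S → (x \ U).card = k - (B ∪ S).card := by
    intro x hx hxU
    have h1 := Finset.card_sdiff_add_card_inter x U
    have h2 := (Finset.mem_powersetCard.1 (hℱ hx)).2
    rw [hxU] at h1
    omega
  have h𝒜sub : 𝒜 ⊆ Finset.powersetCard (k - (B ∪ S).card) Uᶜ := by
    intro z hz
    obtain ⟨x, hx, rfl⟩ := Finset.mem_image.1 hz
    obtain ⟨hx1, hx2⟩ := Finset.mem_filter.1 hx
    exact Finset.mem_powersetCard.2
      ⟨fun a ha => Finset.mem_compl.2 (Finset.mem_sdiff.1 ha).2, hxcard x hx1 hx2⟩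
  have h𝒜card : 𝒜.card = sliceCard ℱ U (B ∪ S) := by
    refine Finset.card_image_of_injOn fun x hx x' hx' hxx' => ?_
    have h1 := (Finset.mem_filter.1 (Finset.mem_coe.1 hx)).2
    have h2 := (Finset.mem_filter.1 (Finset.mem_coe.1 hx')).2
    change x \ U = x' \ U at hxx'
    rw [← Finset.sdiff_union_inter x U, ← Finset.sdiff_union_inter x' U, hxx', h1, h2]
  rw [← h𝒜card] at hdense
  have hn1 : (0 : ℝ) < Fintype.card α := by
    refine hn0.lt_of_ne fun h0 => ?_
    rw [← h0] at hn'
    linarith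
  have hWc : ((Uᶜ).card : ℝ) = Fintype.card α - U.card := by
    rw [Finset.card_compl, Nat.cast_sub (Finset.card_le_univ U)]
  have hUc' : (U.card : ℝ) ≤ M + (h + t) := by exact_mod_cast hUc
  have hU0 : (0 : ℝ) ≤ U.card := Nat.cast_nonneg _
  -- As `U.card ≤ ζn/2`, the gap between `k` and `(1/2 - ζ/2)(n - U.card)` is at least `ζn/4`; then
  -- `8 ≤ ζ²n` yields `n ≤ 2s²`.
  refine half_mul_le_biasedAvg hq0 hq1' h𝒜sub (by positivity) hdense
    (s := ζ * Fintype.card α / 4) (by positivity) ?_ ?_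
    (fun y => ?_) (fun y _ z hz hzy => ?_)
  · have h1 : ((k - (B ∪ S).card : ℕ) : ℝ) ≤ k := by exact_mod_cast Nat.sub_le _ _
    have h2 : (1 / 2 - ζ / 2) * (Fintype.card α - U.card : ℝ) ≤ q * (Fintype.card α - U.card) := by
      refine mul_le_mul_of_nonneg_right hq1 ?_
      rw [← hWc]; positivity
    rw [hWc]
    nlinarith
  · rw [hWc]
    nlinarith
  · rcases upIndicator_eq_zero_or_one ℱ (J ∪ S) (B ∪ S) y with h | h <;> simp [h]
  · obtain ⟨x, hx, rfl⟩ := Finset.mem_image.1 hz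
    obtain ⟨hx1, hx2⟩ := Finset.mem_filter.1 hx
    have hJSU : J ∪ S ⊆ U := Finset.union_subset_union_right hSD
    refine le_of_eq (if_pos ⟨x, hx1, ?_, ?_⟩).symm
    · rw [← Finset.inter_eq_right.2 hJSU, ← Finset.inter_assoc, hx2]
      exact Finset.inter_eq_left.2 (Finset.union_subset_union_left hB)
    · refine subset_trans (fun a ha => ?_) hzy
      obtain ⟨ha1, ha2⟩ := Finset.mem_sdiff.1 ha
      refine Finset.mem_sdiff.2 ⟨ha1, fun haU => ha2 ?_⟩
      have : a ∈ B ∪ S := hx2 ▸ Finset.mem_inter.2 ⟨ha1, haU⟩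
      exact Finset.union_subset_union_left hB this

end Assembly

/-! ### The junta of robust traces. -/

theorem mainTheorem5 (t : ℕ) (ht : 1 ≤ t) (ζ ε : ℝ) (hζ : 0 < ζ) (hε : 0 < ε) :
    ∃ j n₁ : ℕ, ∀ n k : ℕ, n₁ ≤ n → ζ * (n : ℝ) ≤ (k : ℝ) → (k : ℝ) ≤ (1 / 2 - ζ) * (n : ℝ) →
      ∀ ℱ : Finset (Finset (Fin n)), ℱ ⊆ Finset.powersetCard k Finset.univ →
        (∀ A ∈ ℱ, ∀ B ∈ ℱ, A ≠ B → (A ∩ B).card ≠ t - 1) →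
        ∃ 𝒥 : Finset (Finset (Fin n)), IsTIntersecting t 𝒥 ∧ IsJunta k j 𝒥 ∧
          ((ℱ \ 𝒥).card : ℝ) < ε * (n.choose k : ℝ) := by
  classical
  -- For `ζ > 1/4` no `k` satisfies both bounds.
  rcases lt_or_ge (1 / 4) ζ with hζ' | hζ'
  · refine ⟨0, 1, fun n k hn h1 h2 => ?_⟩
    have : (1 : ℝ) ≤ n := by exact_mod_cast hn
    nlinarith
  have hc : 0 < ε / 2 := by positivity
  obtain ⟨h, hh⟩ := exists_half_lt_upIndicator hζ hζ' hc t
  obtain ⟨M, hM⟩ := exists_robust_slices hζ hζ' hc h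
  refine ⟨M, max (max ⌈2 * ((M : ℝ) + h) / ζ⌉₊ ⌈8 / ζ ^ 2⌉₊) (max M ⌈(2 * t + 1) / ζ⌉₊),
    fun n k hn hk1 hk2 ℱ hℱ hF => ?_⟩
  simp only [max_le_iff, Nat.ceil_le] at hn
  obtain ⟨⟨hn1, hn2⟩, hn3, hn4⟩ := hn
  rw [div_le_iff₀ (by positivity)] at hn1 hn2 hn4
  have hcard : Fintype.card (Fin n) = n := Fintype.card_fin n
  have hn1' : 2 * ((M : ℝ) + h) ≤ ζ * (Fintype.card (Fin n) : ℝ) := by rw [hcard]; linarith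
  have hn2' : 8 ≤ ζ ^ 2 * (Fintype.card (Fin n) : ℝ) := by rw [hcard]; linarith
  have hk1' : ζ * (Fintype.card (Fin n) : ℝ) ≤ k := by rwa [hcard]
  have hk2' : (k : ℝ) ≤ (1 / 2 - ζ) * (Fintype.card (Fin n) : ℝ) := by rwa [hcard]
  obtain ⟨J, hJM, hJ⟩ := hM (Fin n) k hk1' hk2' hn1' ℱ hℱ
  -- `J` is padded to exactly `M` points, so that `j = M` is independent of `ℱ`.
  obtain ⟨J₂, hJJ₂, hJ₂⟩ := Finset.exists_superset_card_eq hJM (by rwa [hcard])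
  have htk : t ≤ k := by
    have : (t : ℝ) ≤ k := by linarith [(Nat.cast_nonneg t : (0 : ℝ) ≤ t)]
    exact_mod_cast this
  have htJ : t ≤ (Jᶜ).card := by
    have h1 : M + t ≤ n := by
      have h2 : (0 : ℝ) ≤ h := Nat.cast_nonneg h
      have h3 : (0 : ℝ) ≤ M := Nat.cast_nonneg M
      have h4 : (0 : ℝ) ≤ t := Nat.cast_nonneg t
      have h5 : (n : ℝ) * ζ ≤ n * (1 / 4) := mul_le_mul_of_nonneg_left hζ' (Nat.cast_nonneg n)
      have : (M : ℝ) + t ≤ n := by linarith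
      exact_mod_cast this
    rw [Finset.card_compl, hcard]
    omega
  refine ⟨{x ∈ Finset.powersetCard k (Finset.univ : Finset (Fin n)) | IsRobustSlice k h (ε / 2) ℱ J (x ∩ J)},
    fun A hA B hB => ?_, ⟨J₂, hJ₂, Finset.filter_subset _ _,
      {B ∈ J₂.powerset | IsRobustSlice k h (ε / 2) ℱ J (B ∩ J)}, Finset.filter_subset _ _,
      fun S hS => ?_⟩, ?_⟩
  · by_contra! hlt
    have hA' := (Finset.mem_filter.1 hA).2
    have hB' := (Finset.mem_filter.1 hB).2
    have hr : ((A ∩ J) ∩ (B ∩ J)).card ≤ t - 1 :=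
      (Finset.card_le_card (Finset.inter_subset_inter Finset.inter_subset_left
        Finset.inter_subset_left)).trans (by omega)
    obtain ⟨S, hSJ, hS⟩ := Finset.exists_subset_card_eq
      (show t - 1 - ((A ∩ J) ∩ (B ∩ J)).card ≤ (Jᶜ).card by omega)
    have hd : Disjoint J S := (Finset.subset_compl_iff_disjoint_right.1 hSJ).symm
    have hup := fun C (hC : IsRobustSlice k h (ε / 2) ℱ J (C ∩ J)) =>
      hh (Fin n) k M hk1' hk2' hn1' hn2' ℱ hℱ J (C ∩ J) S hJM Finset.inter_subset_right hd
        (by omega) hC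
    obtain ⟨y, hy1, hy2⟩ := exists_compl_of_half_lt (upIndicator_eq_zero_or_one _ _ _)
      (upIndicator_eq_zero_or_one _ _ _) (hup A hA') (hup B hB')
    obtain ⟨x, hx, hxJ, hxy⟩ := of_not_not fun hne => zero_ne_one ((if_neg hne).symm.trans hy1)
    obtain ⟨z, hz, hzJ, hzy⟩ := of_not_not fun hne => zero_ne_one ((if_neg hne).symm.trans hy2)
    have hxz : x ∩ z = ((A ∩ J) ∩ (B ∩ J)) ∪ S := by
      rw [Finset.inter_union_distrib_right, ← hxJ, ← hzJ]
      ext a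
      have h1 : a ∈ x \ (J ∪ S) → a ∈ y := fun ha => hxy ha
      have h2 : a ∈ z \ (J ∪ S) → a ∈ yᶜ := fun ha => hzy ha
      simp only [Finset.mem_inter, Finset.mem_sdiff, Finset.mem_union, Finset.mem_compl] at h1 h2 ⊢
      tauto
    have hxzc : (x ∩ z).card = t - 1 := by
      rw [hxz, Finset.card_union_of_disjoint, hS]
      · omega
      · exact hd.mono_left (Finset.inter_subset_left.trans Finset.inter_subset_right)
    -- The sets are distinct because `k ≥ t > t - 1`.
    refine hF x hx z hz (fun hne => ?_) hxzc
    rw [hne, Finset.inter_self, (Finset.mem_powersetCard.1 (hℱ hz)).2] at hxzc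
    omega
  · have hSJ : S ∩ J₂ ∩ J = S ∩ J := by
      rw [Finset.inter_assoc, Finset.inter_eq_right.2 hJJ₂]
    simp [Finset.mem_filter, hS, hSJ, Finset.inter_subset_right]
  · rw [hcard, mul_div_cancel₀ ε two_ne_zero] at hJ
    refine lt_of_le_of_lt ?_ hJ
    rw [Finset.card_eq_sum_card_fiberwise (f := fun x => x ∩ J)
      (t := J.powerset.filter fun B => ¬ IsRobustSlice k h (ε / 2) ℱ J B), Nat.cast_sum]
    · refine Finset.sum_le_sum fun B _ => ?_
      exact_mod_cast sliceCard_mono Finset.sdiff_subset J B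
    · intro x hx
      obtain ⟨hx1, hx2⟩ := Finset.mem_sdiff.1 (Finset.mem_coe.1 hx)
      exact Finset.mem_coe.2 (Finset.mem_filter.2 ⟨Finset.mem_powerset.2 Finset.inter_subset_right,
        fun hrob => hx2 (Finset.mem_filter.2 ⟨hℱ hx1, hrob⟩)⟩)
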